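/- **Setting.** There are $M$ messages and $K$ contexts, and one user arrives per timeslot $t=1,2,\dots$ (no broadcasting). The contexts $x_t\in\{1,\dots,K\}$ are i.i.d. and uniform. The server sees $x_t$, recommends a message $a_t$ on the basis of the past and of $x_t$ (and possibly of additional independent randomness), and observes the payoff $r_t(x_t,a_t)$. The payoffs $r_t(k,m)\in[0,1]$ are i.i.d. over time with an unknown law $P_{k,m}$ and are independent of the past and of $x_t$; $\mu(k,m)$ is the mean of $P_{k,m}$. The means only take values in $\{\Delta,2\Delta,3\Delta,\dots\}\cap[0,1]$, where $\Delta\ge\underline\Delta$ and $\underline\Delta>0$ is a constant known to the server. The messages are partitioned into $L$ nonempty content types, unknown to the server, such that for every context $k$ two messages $m_1,m_2$ are of the same type if and only if $\mu(k,m_1)=\mu(k,m_2)$. The regret is $R(T)=\mathbb E\big[\sum_{t=1}^T\max_m\mu(x_t,m)-\sum_{t=1}^T r_t(x_t,a_t)\big]$. **Algorithm 2.** *Initialization.* Let $s$ be the least integer for which there are $K$ sets of $s$ messages each that together cover all pairs of messages (each pair is contained in one of the sets). Fix such sets $\mathcal S_1,\dots,\mathcal S_K$, allocate $\mathcal S_k$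 to context $k$, and assign each pair $\{m_1,m_2\}$ to one context $x_{m_1,m_2}$ whose set contains it. Fix, for each partition of the messages, a set consisting of one representative of each class. *Timeslot $t$.* Let $Z(k,m)$ be the number of times message $m$ was recommended in context $k$ before slot $t$, $\bar r(k,m)$ the average of the payoffs observed then ($0$ if $Z(k,m)=0$), and $D(t)=\frac{32}{\underline\Delta^2}\log t$. Let $k=x_t$. (1) If some $m\in\mathcal S_k$ has $Z(k,m)<D(t)$, recommend any such $m$. (2) Otherwise cluster the messages: start with singletons; let the distance of two clusters be the maximum of $|\bar r(x_{m_1,m_2},m_1)-\bar r(x_{m_1,m_2},m_2)|$ over $m_1$ in the one and $m_2$ in the other; as long as the smallest distance of two different clusters is less than $\underline\Delta/2$, merge two clusters at smallest distance. Take the representatives of the resulting partition. If some representative $m$ has $Z(k,m)<D(t)$, recommend any such $m$. (3) Otherwise recommend a representative that maximizes $\bar r(k,\cdot)$. All ties are broken arbitrarily. **Theorem.** For every $\underline\Delta>0$ there is a constant $C$, depending only on $\underline\Delta$, such that for all $K,M,L$, all payoff laws as above, every possible choice in the initialization, every way of breaking ties, and all $T\ge2$, $$R(T)\le C\left(KM\sqrt{\frac{\log(MK)}{K}}+KL\right)\log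 T .$$ -/

import Mathlib

open MeasureTheory ProbabilityTheory

noncomputable section

namespace LatentBandit

/-! ### The environment

Contexts are `Fin K`, messages are `Fin M`, timeslots are `1, 2, 3, …` (index `0` of every
sequence is unused). -/

/-- The average payoff `μ(k, m)` of message `m` in context `k`, for payoff laws `P k m`. -/
def meanPayoff {K M : ℕ} (P : Fin K → Fin M → Measure ℝ) (k : Fin K) (m : Fin M) : ℝ :=
  ∫ y, y ∂(P k m)

/-- Payoffs are random variables with values in `[0, 1]`. -/
def IsPayoffLaw {K M : ℕ} (P : Fin K → Fin M → Measure ℝ) : Prop :=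
  ∀ k m, IsProbabilityMeasure (P k m) ∧ ∀ᵐ y ∂(P k m), y ∈ Set.Icc (0 : ℝ) 1

/-- Discrete payoff structure: average payoffs only take the values `Δ, 2Δ, 3Δ, … ≤ 1`. -/
def DiscretePayoffs {K M : ℕ} (μ : Fin K → Fin M → ℝ) (Δ : ℝ) : Prop :=
  ∀ k m, (∃ j : ℕ, 1 ≤ j ∧ μ k m = j * Δ) ∧ μ k m ≤ 1

/-- Latent content types: `ty m` is the content type of the message `m`. There are `L`
(nonempty) types, and in every context two messages have the same average payoff exactly if
they are of the same type. -/
def LatentTypes {K M L : ℕ} (μ : Fin K → Fin M → ℝ) (ty : Fin M → Fin L) : Prop :=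
  Function.Surjective ty ∧ ∀ k m₁ m₂, ty m₁ = ty m₂ ↔ μ k m₁ = μ k m₂

/-- The interaction of a server with the environment, one user per timeslot and no broadcasting.
`ℱ t` is the information at the end of slot `t` (it may contain additional randomness, for
breaking ties); `x t` is the context of the user of slot `t`, `a t` the message recommended
to that user, and `r t k m` the payoff that message `m` has in slot `t` in context `k`, of which
only `r t (x t) (a t)` is observed. Contexts are i.i.d. and uniform, payoffs are
i.i.d. over time with laws `P k m` and independent of the contexts, and the recommendation of a
slot is made from the past and from the current context. -/
structure Interaction {K M : ℕ} {Ω : Type*} [mΩ : MeasurableSpace Ω] (Pr : Measure Ω)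
    (P : Fin K → Fin M → Measure ℝ) (ℱ : Filtration ℕ mΩ)
    (x : ℕ → Ω → Fin K) (a : ℕ → Ω → Fin M) (r : ℕ → Fin K → Fin M → Ω → ℝ) : Prop where
  context_measurable : ∀ t, Measurable[ℱ (t + 1)] (x (t + 1))
  payoff_measurable : ∀ t k m, Measurable[ℱ (t + 1)] (r (t + 1) k m)
  context_uniform : ∀ t k, Pr.real {ω | x (t + 1) ω = k} = 1 / (K : ℝ)
  context_indep : ∀ t, Indep (MeasurableSpace.comap (x (t + 1)) ⊤) (ℱ t) Pr
  payoff_law : ∀ t k m, Pr.map (r (t + 1) k m) = P k m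
  payoff_indep : ∀ t k m, Indep (MeasurableSpace.comap (r (t + 1) k m) inferInstance)
    (ℱ t ⊔ MeasurableSpace.comap (x (t + 1)) ⊤) Pr
  action_measurable : ∀ t,
    Measurable[ℱ t ⊔ MeasurableSpace.comap (x (t + 1)) ⊤] (a (t + 1))

/-- The regret `R(T) = 𝔼 [∑_{t ≤ T} max_m μ(x_t, m) - ∑_{t ≤ T} r_t(x_t, a_t)]`. -/
def regret {K M : ℕ} {Ω : Type*} [MeasurableSpace Ω] (Pr : Measure Ω)
    (P : Fin K → Fin M → Measure ℝ)
    (x : ℕ → Ω → Fin K) (a : ℕ → Ω → Fin M) (r : ℕ → Fin K → Fin M → Ω → ℝ) (T : ℕ) : ℝ :=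
  ∫ ω, ((∑ t ∈ Finset.Icc 1 T, ⨆ m, meanPayoff P (x t ω) m)
    - ∑ t ∈ Finset.Icc 1 T, r t (x t ω) (a t ω) ω) ∂Pr

/-! ### Statistics of a sample path

Here `x`, `a`, `y` are the contexts, recommendations and observed payoffs on one path. All
statistics "at slot `t`" are those available when the recommendation of slot `t` is made, that
is, they run over the slots `1, …, t - 1`. -/

/-- The slots before `t` in which message `m` was recommended in context `k`. -/
def pastSlots {K M : ℕ} (x : ℕ → Fin K) (a : ℕ → Fin M) (t : ℕ) (k : Fin K) (m : Fin M) :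
    Finset ℕ :=
  (Finset.Ico 1 t).filter (fun u => x u = k ∧ a u = m)

/-- `Z(k, t, m)`: how often `m` has been recommended in context `k`. -/
def count {K M : ℕ} (x : ℕ → Fin K) (a : ℕ → Fin M) (t : ℕ) (k : Fin K) (m : Fin M) : ℕ :=
  (pastSlots x a t k m).card

/-- The average payoff realized so far by `m` in context `k` (`0` without samples). -/
def empMean {K M : ℕ} (x : ℕ → Fin K) (a : ℕ → Fin M) (y : ℕ → ℝ) (t : ℕ)
    (k : Fin K) (m : Fin M) : ℝ :=
  (∑ u ∈ pastSlots x a t k m, y u) / (count x a t k m : ℝ)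

/-- The exploration threshold `D(t) = (32 / δ²) log t`, where `δ` is the known lower bound of
the payoff resolution. -/
def threshold (δ : ℝ) (t : ℕ) : ℝ := 32 / δ ^ 2 * Real.log t

/-! ### Routine 1: allocating message pairs to contexts -/

/-- `S` is a family of `K` sets of `s` messages such that every pair of messages is contained in
one of the sets. -/
def CoversPairs {K M : ℕ} (S : Fin K → Finset (Fin M)) (s : ℕ) : Prop :=
  (∀ k, (S k).card = s) ∧ ∀ m₁ m₂, m₁ ≠ m₂ → ∃ k, m₁ ∈ S k ∧ m₂ ∈ S k

/-- `S` and `c` are a possible result of Routine 1: `S` is a covering design of `K` sets whose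
common size is as small as possible, the set `S k` is allocated to the context `k`, and each
pair of messages is assigned to one context whose set contains the pair. -/
def IsPairAllocation {K M : ℕ} (S : Fin K → Finset (Fin M)) (c : Sym2 (Fin M) → Fin K) : Prop :=
  (∃ s, CoversPairs S s ∧ ∀ (S' : Fin K → Finset (Fin M)) (s' : ℕ), CoversPairs S' s' → s ≤ s') ∧
  ∀ m₁ m₂, m₁ ≠ m₂ → m₁ ∈ S (c s(m₁, m₂)) ∧ m₂ ∈ S (c s(m₁, m₂))

/-! ### Routine 2: clustering into content types -/

/-- The estimated payoff difference of `m₁` and `m₂`, in the context their pair is assigned to. -/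
def pairDist {K M : ℕ} (c : Sym2 (Fin M) → Fin K) (x : ℕ → Fin K) (a : ℕ → Fin M) (y : ℕ → ℝ)
    (t : ℕ) (m₁ m₂ : Fin M) : ℝ :=
  |empMean x a y t (c s(m₁, m₂)) m₁ - empMean x a y t (c s(m₁, m₂)) m₂|

/-- Distance of two clusters: the maximal distance of two of their members. -/
def clusterDist {M : ℕ} (d : Fin M → Fin M → ℝ) (A B : Finset (Fin M)) : ℝ :=
  ⨆ p : {p : Fin M × Fin M // p.1 ∈ A ∧ p.2 ∈ B}, d p.1.1 p.1.2

/-- One step of the clustering: two different clusters whose distance is minimal, and smaller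
than `θ`, are merged. -/
def MergeStep {M : ℕ} (d : Fin M → Fin M → ℝ) (θ : ℝ) (𝒞 𝒞' : Finset (Finset (Fin M))) : Prop :=
  ∃ A ∈ 𝒞, ∃ B ∈ 𝒞, A ≠ B ∧
    (∀ A' ∈ 𝒞, ∀ B' ∈ 𝒞, A' ≠ B' → clusterDist d A B ≤ clusterDist d A' B') ∧
    clusterDist d A B < θ ∧
    𝒞' = insert (A ∪ B) ((𝒞.erase A).erase B)

/-- `𝒞` is a possible output of the clustering: it is obtained from the clustering into
singletons by merging as long as the minimal distance is smaller than `θ`. -/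
def IsClustering {M : ℕ} (d : Fin M → Fin M → ℝ) (θ : ℝ) (𝒞 : Finset (Finset (Fin M))) : Prop :=
  Relation.ReflTransGen (MergeStep d θ) (Finset.univ.image fun m => {m}) 𝒞 ∧
  ∀ A ∈ 𝒞, ∀ B ∈ 𝒞, A ≠ B → θ ≤ clusterDist d A B

/-- A rule that selects one representative of each content type. The set of representatives is a
function of the partition alone. -/
def IsRepresentativeRule {M : ℕ} (rep : Finset (Finset (Fin M)) → Finset (Fin M)) : Prop :=
  ∀ 𝒞 : Finpartition (Finset.univ : Finset (Fin M)), ∀ A ∈ 𝒞.parts, (rep 𝒞.parts ∩ A).card = 1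

/-! ### The algorithm -/

/-- Either recommend a message of `R` with fewer than `D(t)` recommendations in the current
context, any one of them, or, if there is none, a message that satisfies `otherwise`. -/
def ExploreOr {K M : ℕ} (δ : ℝ) (x : ℕ → Fin K) (a : ℕ → Fin M) (t : ℕ) (R : Finset (Fin M))
    (otherwise : Prop) : Prop :=
  (a t ∈ R ∧ (count x a t (x t) (a t) : ℝ) < threshold δ t) ∨
  ((∀ m ∈ R, threshold δ t ≤ (count x a t (x t) m : ℝ)) ∧ otherwise)

/-- The recommendation `a t` of slot `t` is one that the algorithm can make: Exploration 1 on the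
set `S k` of the current context `k = x t`; if nothing is left to explore there, clustering of
the messages and Exploration 2 on the representatives; if nothing is left to explore there
either, exploitation. -/
def AlgorithmStep {K M : ℕ} (δ : ℝ) (S : Fin K → Finset (Fin M)) (c : Sym2 (Fin M) → Fin K)
    (rep : Finset (Finset (Fin M)) → Finset (Fin M))
    (x : ℕ → Fin K) (a : ℕ → Fin M) (y : ℕ → ℝ) (t : ℕ) : Prop :=
  ExploreOr δ x a t (S (x t)) <|
    ∃ 𝒞, IsClustering (pairDist c x a y t) (δ / 2) 𝒞 ∧
      ExploreOr δ x a t (rep 𝒞)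
        (a t ∈ rep 𝒞 ∧ ∀ m ∈ rep 𝒞, empMean x a y t (x t) m ≤ empMean x a y t (x t) (a t))

end LatentBandit

end

noncomputable section

namespace LatentBandit

/-! ### Counting explorations -/

/-! A slot costs at most 1 in terms of means, so it suffices to count the slots that can cost
anything. Let s be the size of the sets and D = D(T). Call slot t good if every pair (k, m) with m
in S k or a true representative, and with at least D(t)/2 samples, is estimated within δ/4, and if
every m in S k has D(t)/2 samples. In a good slot the distances of different types exceed δ/2 and
those of equal types stay below it, so the clustering returns exactly the types. The representatives
are then one fixed set of at most L messages, and exploitation is optimal (`AlgorithmStep.cases`).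
The explorations in good slots number at most K(s + L)(D + 1), because a message stops being
explored in a context after about D samples.

An estimate fails with probability at most 2/t². The number of samples is random and depends on the
payoffs, so this comes from an exponential supermartingale
(`Interaction.lintegral_prod_expFactor_le`), not from Hoeffding's inequality for a fixed number of
samples. Summed over t, the failures cost O(K(s + L)).

The delicate point is that clustering in context `x t` uses samples from other contexts, whose
exploration may lag behind. If some m in S k has fewer than D(t)/2 samples, every arrival of k in
the second half of [1, t) was spent on Exploration 1, so there were at most b = s(D + 1) of them
(`card_arrivals_le_of_underexplored`). For t > 16Kb + 4 this is improbable by a Chernoff bound, and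
the earlier slots are simply charged in full.

Finally, s is of order M/√K + 1 by an explicit covering (`exists_coversPairs`). The logarithm under
the root in the theorem serves only as a factor bounded below, and the additive constant is absorbed
in KL. -/

theorem pastSlots_mono {K M : ℕ} (x : ℕ → Fin K) (a : ℕ → Fin M) {t u : ℕ} (h : t ≤ u)
    (k : Fin K) (m : Fin M) : pastSlots x a t k m ⊆ pastSlots x a u k m := by
  intro v hv
  simp only [pastSlots, Finset.mem_filter, Finset.mem_Ico] at hv ⊢
  exact ⟨⟨hv.1.1, hv.1.2.trans_le h⟩, hv.2⟩

theorem count_mono {K M : ℕ} (x : ℕ → Fin K) (a : ℕ → Fin M) {t u : ℕ} (h : t ≤ u)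
    (k : Fin K) (m : Fin M) : count x a t k m ≤ count x a u k m :=
  Finset.card_le_card (pastSlots_mono x a h k m)

/-- At most `D + 1` slots can recommend a message that has fewer than `D` samples. -/
theorem card_underexplored_message_le {K M : ℕ} (x : ℕ → Fin K) (a : ℕ → Fin M) (N : ℕ)
    {D : ℝ} (hD : 0 ≤ D) (k : Fin K) (m : Fin M) :
    (((Finset.Icc 1 N).filter
      (fun u => x u = k ∧ a u = m ∧ (count x a u k m : ℝ) < D)).card : ℝ) ≤ D + 1 := by
  set E := (Finset.Icc 1 N).filter (fun u => x u = k ∧ a u = m ∧ (count x a u k m : ℝ) < D)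
    with hE
  rcases E.eq_empty_or_nonempty with h | h
  · rw [h]; simp only [Finset.card_empty, Nat.cast_zero]; linarith
  -- In the last such slot the count is still below D, and it already includes all the other such
  -- slots.
  · have hmem := E.max'_mem h
    set v := E.max' h with hv
    have hsub : E.erase v ⊆ pastSlots x a v k m := by
      intro u hu
      rw [Finset.mem_erase] at hu
      have hle := E.le_max' u hu.2
      have hu' := hu.2
      simp only [hE, Finset.mem_filter, Finset.mem_Icc] at hu'
      simp only [pastSlots, Finset.mem_filter, Finset.mem_Ico]
      exact ⟨⟨hu'.1.1, lt_of_le_of_ne hle hu.1⟩, hu'.2.1, hu'.2.2.1⟩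
    have hc := Finset.card_le_card hsub
    rw [Finset.card_erase_of_mem hmem] at hc
    have hc' : E.card ≤ count x a v k m + 1 := by unfold count; omega
    have hlt : (count x a v k m : ℝ) < D := by
      have := hmem
      simp only [hE, Finset.mem_filter] at this
      exact this.2.2.2
    have : (E.card : ℝ) ≤ (count x a v k m : ℝ) + 1 := by exact_mod_cast hc'
    linarith

theorem card_underexplored_context_le {K M : ℕ} (x : ℕ → Fin K) (a : ℕ → Fin M) (N : ℕ)
    {D : ℝ} (hD : 0 ≤ D) (k : Fin K) (S : Finset (Fin M)) :
    (((Finset.Icc 1 N).filter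
      (fun u => x u = k ∧ a u ∈ S ∧ (count x a u k (a u) : ℝ) < D)).card : ℝ)
      ≤ S.card * (D + 1) := by
  rw [Finset.card_eq_sum_card_fiberwise (f := a) (t := S)]
  · push_cast
    rw [← nsmul_eq_mul]
    refine Finset.sum_le_card_nsmul _ _ _ fun m _ => le_trans ?_
      (card_underexplored_message_le x a N hD k m)
    refine Nat.cast_le.2 (Finset.card_le_card ?_)
    intro u hu
    simp only [Finset.mem_filter] at hu ⊢
    obtain ⟨⟨h1, h2, h3, h4⟩, h5⟩ := hu
    rw [h5] at h4
    exact ⟨h1, h2, h5, h4⟩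
  · intro u hu
    simp only [Finset.coe_filter, Set.mem_ofPred_eq] at hu
    exact hu.2.2.1

theorem card_underexplored_le {K M : ℕ} (x : ℕ → Fin K) (a : ℕ → Fin M) (N : ℕ)
    {D : ℝ} (hD : 0 ≤ D) (S : Fin K → Finset (Fin M)) {s : ℕ} (hS : ∀ k, (S k).card ≤ s) :
    (((Finset.Icc 1 N).filter
      (fun u => a u ∈ S (x u) ∧ (count x a u (x u) (a u) : ℝ) < D)).card : ℝ)
      ≤ K * (s * (D + 1)) := by
  rw [Finset.card_eq_sum_card_fiberwise (f := x) (t := Finset.univ) (fun _ _ => Finset.mem_univ _)]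
  push_cast
  have hK : (K : ℝ) * (s * (D + 1)) = (Finset.univ : Finset (Fin K)).card • (s * (D + 1)) := by
    simp
  rw [hK]
  refine Finset.sum_le_card_nsmul _ _ _ fun k _ => le_trans ?_ (le_trans
      (card_underexplored_context_le x a N hD k (S k)) ?_)
  · refine Nat.cast_le.2 (Finset.card_le_card ?_)
    intro u hu
    simp only [Finset.mem_filter] at hu ⊢
    obtain ⟨⟨h1, h2, h3⟩, h5⟩ := hu
    rw [h5] at h2 h3
    exact ⟨h1, h5, h2, h3⟩
  · have : ((S k).card : ℝ) ≤ s := by exact_mod_cast hS k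
    exact mul_le_mul_of_nonneg_right this (by linarith)

/-! ### Complete linkage clustering -/

theorem le_clusterDist {M : ℕ} (d : Fin M → Fin M → ℝ) {A B : Finset (Fin M)} {m₁ m₂ : Fin M}
    (h₁ : m₁ ∈ A) (h₂ : m₂ ∈ B) : d m₁ m₂ ≤ clusterDist d A B :=
  le_ciSup (f := fun p : {p : Fin M × Fin M // p.1 ∈ A ∧ p.2 ∈ B} => d p.1.1 p.1.2)
    (Set.finite_range _).bddAbove ⟨(m₁, m₂), h₁, h₂⟩

/-- The supremum is attained because the family is finite. Nonemptiness matters: a real supremum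
over an empty family is 0, which need not be below `θ`. -/
theorem clusterDist_lt {M : ℕ} {d : Fin M → Fin M → ℝ} {A B : Finset (Fin M)} {θ : ℝ}
    (hA : A.Nonempty) (hB : B.Nonempty) (h : ∀ m₁ ∈ A, ∀ m₂ ∈ B, d m₁ m₂ < θ) :
    clusterDist d A B < θ := by
  obtain ⟨m₁, h₁⟩ := hA
  obtain ⟨m₂, h₂⟩ := hB
  have : Nonempty {p : Fin M × Fin M // p.1 ∈ A ∧ p.2 ∈ B} := ⟨⟨(m₁, m₂), h₁, h₂⟩⟩
  obtain ⟨p, hp⟩ := exists_eq_ciSup_of_finite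
    (f := fun p : {p : Fin M × Fin M // p.1 ∈ A ∧ p.2 ∈ B} => d p.1.1 p.1.2)
  unfold clusterDist
  rw [← hp]
  exact h _ p.2.1 _ p.2.2

/-- The clusters partition the messages and do not mix types. -/
structure RefinesTypes {M : ℕ} {ι : Type*} (ty : Fin M → ι) (𝒞 : Finset (Finset (Fin M))) :
    Prop where
  nonempty : ∀ A ∈ 𝒞, A.Nonempty
  cover : ∀ m, ∃ A ∈ 𝒞, m ∈ A
  disjoint : ∀ A ∈ 𝒞, ∀ B ∈ 𝒞, A ≠ B → Disjoint A B
  type_eq : ∀ A ∈ 𝒞, ∀ m₁ ∈ A, ∀ m₂ ∈ A, ty m₁ = ty m₂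

/-- Complete linkage bounds every cross distance of the merged clusters by `θ`, so all their members
share a type. Disjointness makes each cross pair consist of distinct messages, the only pairs `hd`
speaks of. -/
theorem RefinesTypes.mergeStep {M : ℕ} {ι : Type*} {ty : Fin M → ι} {d : Fin M → Fin M → ℝ}
    {θ : ℝ} (hd : ∀ m₁ m₂, m₁ ≠ m₂ → (d m₁ m₂ < θ ↔ ty m₁ = ty m₂))
    {𝒞 𝒞' : Finset (Finset (Fin M))} (h𝒞 : RefinesTypes ty 𝒞) (h : MergeStep d θ 𝒞 𝒞') :
    RefinesTypes ty 𝒞' := by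
  obtain ⟨A, hA, B, hB, hAB, -, hlt, rfl⟩ := h
  have hAB' : ∀ m₁ ∈ A, ∀ m₂ ∈ B, ty m₁ = ty m₂ := fun m₁ h₁ m₂ h₂ =>
    (hd m₁ m₂ (Finset.disjoint_iff_ne.1 (h𝒞.disjoint A hA B hB hAB) m₁ h₁ m₂ h₂)).1
      ((le_clusterDist d h₁ h₂).trans_lt hlt)
  have hmem : ∀ X, X ∈ insert (A ∪ B) ((𝒞.erase A).erase B) ↔
      X = A ∪ B ∨ (X ≠ B ∧ X ≠ A ∧ X ∈ 𝒞) := by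
    intro X; simp only [Finset.mem_insert, Finset.mem_erase]
  have hdis : ∀ X, X ≠ B → X ≠ A → X ∈ 𝒞 → Disjoint X (A ∪ B) := fun X h1 h2 h3 =>
    Finset.disjoint_union_right.2 ⟨h𝒞.disjoint X h3 A hA h2, h𝒞.disjoint X h3 B hB h1⟩
  refine ⟨?_, ?_, ?_, ?_⟩
  · intro X hX
    rcases (hmem X).1 hX with rfl | ⟨-, -, h⟩
    · exact (h𝒞.nonempty A hA).mono Finset.subset_union_left
    · exact h𝒞.nonempty X h
  · intro m
    obtain ⟨X, hX, hm⟩ := h𝒞.cover m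
    by_cases h : X = A ∨ X = B
    · refine ⟨A ∪ B, (hmem _).2 (Or.inl rfl), ?_⟩
      rcases h with rfl | rfl
      · exact Finset.mem_union_left _ hm
      · exact Finset.mem_union_right _ hm
    · push Not at h
      exact ⟨X, (hmem _).2 (Or.inr ⟨h.2, h.1, hX⟩), hm⟩
  · intro X hX Y hY hXY
    rcases (hmem X).1 hX with rfl | ⟨h1, h2, h3⟩ <;>
      rcases (hmem Y).1 hY with rfl | ⟨h1', h2', h3'⟩
    · exact absurd rfl hXY
    · exact (hdis Y h1' h2' h3').symm
    · exact hdis X h1 h2 h3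
    · exact h𝒞.disjoint X h3 Y h3' hXY
  · intro X hX m₁ h₁ m₂ h₂
    rcases (hmem X).1 hX with rfl | ⟨-, -, h⟩
    · rcases Finset.mem_union.1 h₁ with h₁ | h₁ <;> rcases Finset.mem_union.1 h₂ with h₂ | h₂
      · exact h𝒞.type_eq A hA _ h₁ _ h₂
      · exact hAB' _ h₁ _ h₂
      · exact (hAB' _ h₂ _ h₁).symm
      · exact h𝒞.type_eq B hB _ h₁ _ h₂
    · exact h𝒞.type_eq X h _ h₁ _ h₂

/-- The partition of the messages into content types. -/
def typeClasses {M L : ℕ} (ty : Fin M → Fin L) : Finset (Finset (Fin M)) :=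
  Finset.univ.image fun m => Finset.univ.filter fun m' => ty m' = ty m

/-- If the distances separate the types at level `θ`, the clustering finds the types. -/
theorem IsClustering.eq_typeClasses {M L : ℕ} {ty : Fin M → Fin L} {d : Fin M → Fin M → ℝ}
    {θ : ℝ} (hd : ∀ m₁ m₂, m₁ ≠ m₂ → (d m₁ m₂ < θ ↔ ty m₁ = ty m₂))
    {𝒞 : Finset (Finset (Fin M))} (h : IsClustering d θ 𝒞) : 𝒞 = typeClasses ty := by
  obtain ⟨hsteps, hfinal⟩ := h
  have hinit : RefinesTypes ty (Finset.univ.image fun m : Fin M => ({m} : Finset (Fin M))) := by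
    refine ⟨?_, ?_, ?_, ?_⟩
    · intro A hA
      obtain ⟨m, -, rfl⟩ := Finset.mem_image.1 hA
      exact Finset.singleton_nonempty m
    · exact fun m => ⟨{m}, Finset.mem_image.2 ⟨m, Finset.mem_univ _, rfl⟩,
        Finset.mem_singleton_self m⟩
    · intro A hA B hB hAB
      obtain ⟨m, -, rfl⟩ := Finset.mem_image.1 hA
      obtain ⟨m', -, rfl⟩ := Finset.mem_image.1 hB
      rw [Finset.disjoint_singleton]
      rintro rfl
      exact hAB rfl
    · intro A hA m₁ h₁ m₂ h₂
      obtain ⟨m, -, rfl⟩ := Finset.mem_image.1 hA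
      rw [Finset.mem_singleton] at h₁ h₂
      rw [h₁, h₂]
  have hinv : RefinesTypes ty 𝒞 := by
    clear hfinal
    induction hsteps with
    | refl => exact hinit
    | tail _ hstep ih => exact ih.mergeStep hd hstep
  have hclass : ∀ A ∈ 𝒞, ∀ m ∈ A, A = Finset.univ.filter fun m' => ty m' = ty m := by
    intro A hA m hm
    ext m'
    simp only [Finset.mem_filter, Finset.mem_univ, true_and]
    refine ⟨fun h => hinv.type_eq A hA _ h _ hm, fun h => ?_⟩
    obtain ⟨B, hB, hm'⟩ := hinv.cover m'
    by_cases hAB : A = B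
    · rwa [hAB]
    · have hdisj := Finset.disjoint_iff_ne.1 (hinv.disjoint A hA B hB hAB)
      -- If a type were split over two clusters, all their cross distances would be below `θ` and
      -- merging could not have stopped.
      refine absurd (hfinal A hA B hB hAB) (not_le.2 (clusterDist_lt ⟨m, hm⟩ ⟨m', hm'⟩ ?_))
      intro m₁ h₁ m₂ h₂
      refine (hd m₁ m₂ (hdisj m₁ h₁ m₂ h₂)).2 ?_
      rw [hinv.type_eq A hA m₁ h₁ m hm, ← h, hinv.type_eq B hB m' hm' m₂ h₂]
  ext A
  simp only [typeClasses, Finset.mem_image, Finset.mem_univ, true_and]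
  constructor
  · intro hA
    obtain ⟨m, hm⟩ := hinv.nonempty A hA
    exact ⟨m, (hclass A hA m hm).symm⟩
  · rintro ⟨m, rfl⟩
    obtain ⟨B, hB, hm⟩ := hinv.cover m
    rw [← hclass B hB m hm]
    exact hB

/-- A representative rule is constrained only on the parts of a `Finpartition`; this makes it
applicable to the true types. -/
theorem exists_finpartition_typeClasses {M L : ℕ} (ty : Fin M → Fin L) :
    ∃ 𝒞 : Finpartition (Finset.univ : Finset (Fin M)), 𝒞.parts = typeClasses ty := by
  refine ⟨Finpartition.ofExistsUnique (typeClasses ty) (fun _ _ => Finset.subset_univ _) ?_ ?_, rfl⟩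
  · intro m _
    refine ⟨Finset.univ.filter fun m' => ty m' = ty m,
      ⟨Finset.mem_image.2 ⟨m, Finset.mem_univ _, rfl⟩, by simp⟩, ?_⟩
    rintro A ⟨hA, hm⟩
    obtain ⟨m', -, rfl⟩ := Finset.mem_image.1 hA
    simp only [Finset.mem_filter, Finset.mem_univ, true_and] at hm
    rw [hm]
  · intro h
    obtain ⟨m, -, hm⟩ := Finset.mem_image.1 h
    have : m ∈ (∅ : Finset (Fin M)) := by rw [← hm]; simp
    simp at this

theorem IsRepresentativeRule.exists_mem {M L : ℕ}
    {rep : Finset (Finset (Fin M)) → Finset (Fin M)} (hrep : IsRepresentativeRule rep)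
    (ty : Fin M → Fin L) (m : Fin M) : ∃ m' ∈ rep (typeClasses ty), ty m' = ty m := by
  obtain ⟨𝒞, h𝒞⟩ := exists_finpartition_typeClasses ty
  have h := hrep 𝒞 (Finset.univ.filter fun m' => ty m' = ty m)
    (h𝒞 ▸ Finset.mem_image.2 ⟨m, Finset.mem_univ _, rfl⟩)
  obtain ⟨m', hm'⟩ := Finset.card_pos.1 (h ▸ Nat.one_pos)
  rw [h𝒞] at hm'
  simp only [Finset.mem_inter, Finset.mem_filter, Finset.mem_univ, true_and] at hm'
  exact ⟨m', hm'⟩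

theorem IsRepresentativeRule.card_le {M L : ℕ}
    {rep : Finset (Finset (Fin M)) → Finset (Fin M)} (hrep : IsRepresentativeRule rep)
    (ty : Fin M → Fin L) : (rep (typeClasses ty)).card ≤ L := by
  obtain ⟨𝒞, h𝒞⟩ := exists_finpartition_typeClasses ty
  have hinj : Set.InjOn ty (rep (typeClasses ty)) := by
    intro m₁ h₁ m₂ h₂ h
    have hc := hrep 𝒞 (Finset.univ.filter fun m' => ty m' = ty m₂)
      (h𝒞 ▸ Finset.mem_image.2 ⟨m₂, Finset.mem_univ _, rfl⟩)
    rw [h𝒞] at hc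
    refine Finset.card_le_one.1 hc.le _ ?_ _ ?_
    · exact Finset.mem_inter.2 ⟨h₁, by simpa using h⟩
    · exact Finset.mem_inter.2 ⟨h₂, by simp⟩
  calc (rep (typeClasses ty)).card = ((rep (typeClasses ty)).image ty).card :=
        (Finset.card_image_of_injOn hinj).symm
    _ ≤ L := by simpa using Finset.card_le_univ ((rep (typeClasses ty)).image ty)

/-! ### What the algorithm does in a slot with reliable estimates -/

theorem threshold_nonneg (δ : ℝ) (t : ℕ) : 0 ≤ threshold δ t :=
  mul_nonneg (by positivity) (Real.log_natCast_nonneg t)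

theorem threshold_mono (δ : ℝ) {t u : ℕ} (ht : 1 ≤ t) (h : t ≤ u) :
    threshold δ t ≤ threshold δ u :=
  mul_le_mul_of_nonneg_left
    (Real.log_le_log (by exact_mod_cast ht) (by exact_mod_cast h)) (by positivity)

/-- Since log t ≤ 2 log u, completed exploration at slot `u` still guarantees half of the threshold
up to slot u². This is why the reliability requirement uses D(t)/2. -/
theorem half_threshold_le (δ : ℝ) {t u : ℕ} (ht : 1 ≤ t) (h : t ≤ u ^ 2) :
    threshold δ t / 2 ≤ threshold δ u := by
  have h1 : Real.log t ≤ Real.log ((u : ℝ) ^ 2) :=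
    Real.log_le_log (by exact_mod_cast ht) (by exact_mod_cast h)
  rw [Real.log_pow] at h1
  push_cast at h1
  unfold threshold
  have : 0 ≤ 32 / δ ^ 2 := by positivity
  nlinarith

/-- If a message of `S k` is underexplored in slot `t`, few users had context `k` recently. -/
theorem card_arrivals_le_of_underexplored {K M : ℕ} {δ : ℝ} {S : Fin K → Finset (Fin M)}
    {c : Sym2 (Fin M) → Fin K} {rep : Finset (Finset (Fin M)) → Finset (Fin M)}
    {x : ℕ → Fin K} {a : ℕ → Fin M} {y : ℕ → ℝ}
    (halg : ∀ u, 1 ≤ u → AlgorithmStep δ S c rep x a y u) {t T : ℕ} (ht : 4 ≤ t) (htT : t ≤ T)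
    {k : Fin K} {m : Fin M} (hm : m ∈ S k) (hcount : (count x a t k m : ℝ) < threshold δ t / 2) :
    (((Finset.Ico (t / 2 + 1) t).filter (fun u => x u = k)).card : ℝ)
      ≤ (S k).card * (threshold δ T + 1) := by
  refine le_trans ?_ (card_underexplored_context_le x a T (threshold_nonneg δ T) k (S k))
  refine Nat.cast_le.2 (Finset.card_le_card ?_)
  intro u hu
  simp only [Finset.mem_filter, Finset.mem_Ico, Finset.mem_Icc] at hu ⊢
  obtain ⟨⟨h1, h2⟩, rfl⟩ := hu
  have hu1 : 1 ≤ u := by omega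
  -- In the second half of the slots t ≤ 2u, and u ≥ 2.
  have hsq : t ≤ u ^ 2 := by
    have : t ≤ 2 * u := by omega
    nlinarith
  rcases halg u hu1 with ⟨h3, h4⟩ | ⟨h3, -⟩
  · exact ⟨⟨hu1, by omega⟩, rfl, h3, h4.trans_le (threshold_mono δ hu1 (by omega))⟩
  · exfalso
    have h5 := h3 m hm
    -- Had Exploration 1 been complete at `u`, `m` would have D(u) ≥ D(t)/2 samples by slot `t`.
    have h6 : (count x a u (x u) m : ℝ) ≤ count x a t (x u) m := by
      exact_mod_cast count_mono x a h2.le _ _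
    have h7 := half_threshold_le δ (by omega) hsq
    linarith

theorem DiscretePayoffs.le_abs_sub {K M : ℕ} {μ : Fin K → Fin M → ℝ} {Δ : ℝ} (hΔ : 0 ≤ Δ)
    (h : DiscretePayoffs μ Δ) {k : Fin K} {m₁ m₂ : Fin M} (hne : μ k m₁ ≠ μ k m₂) :
    Δ ≤ |μ k m₁ - μ k m₂| := by
  obtain ⟨⟨i, -, hi⟩, -⟩ := h k m₁
  obtain ⟨⟨j, -, hj⟩, -⟩ := h k m₂
  have hij : i ≠ j := by
    rintro rfl
    exact hne (hi.trans hj.symm)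
  have h1 : (1 : ℝ) ≤ |(i : ℝ) - j| := by
    have : (1 : ℤ) ≤ |(i : ℤ) - j| := Int.one_le_abs (by omega)
    exact_mod_cast this
  rw [hi, hj, ← sub_mul, abs_mul, abs_of_nonneg hΔ]
  nlinarith

/-- With reliable estimates, a slot explores a message of `S (x t)` or a true representative, or
it recommends an optimal message. -/
theorem AlgorithmStep.cases {K M L : ℕ} {δ Δ : ℝ} {μ : Fin K → Fin M → ℝ} {ty : Fin M → Fin L}
    (hδ : 0 < δ) (hΔ : δ ≤ Δ) (hμ : DiscretePayoffs μ Δ) (hty : LatentTypes μ ty)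
    {S : Fin K → Finset (Fin M)} {c : Sym2 (Fin M) → Fin K}
    {rep : Finset (Finset (Fin M)) → Finset (Fin M)} (hS : IsPairAllocation S c)
    (hrep : IsRepresentativeRule rep)
    {x : ℕ → Fin K} {a : ℕ → Fin M} {y : ℕ → ℝ} {t : ℕ}
    (halg : AlgorithmStep δ S c rep x a y t)
    (hexpl : ∀ k, ∀ m ∈ S k, threshold δ t / 2 ≤ count x a t k m)
    (hest : ∀ k m, m ∈ S k ∪ rep (typeClasses ty) → threshold δ t / 2 ≤ count x a t k m →
      |empMean x a y t k m - μ k m| < δ / 4) :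
    (a t ∈ S (x t) ∧ (count x a t (x t) (a t) : ℝ) < threshold δ t) ∨
    (a t ∈ rep (typeClasses ty) ∧ (count x a t (x t) (a t) : ℝ) < threshold δ t) ∨
    ⨆ m, μ (x t) m = μ (x t) (a t) := by
  have hth := threshold_nonneg δ t
  rcases halg with h | ⟨-, 𝒞, h𝒞, h⟩
  · exact Or.inl h
  -- Two errors below δ/4 shift a difference by less than δ/2, while the true difference is 0 or at
  -- least Δ ≥ δ.
  · have hd : ∀ m₁ m₂, m₁ ≠ m₂ → (pairDist c x a y t m₁ m₂ < δ / 2 ↔ ty m₁ = ty m₂) := by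
      intro m₁ m₂ hne
      obtain ⟨h1, h2⟩ := hS.2 m₁ m₂ hne
      have e1 := hest _ m₁ (Finset.mem_union_left _ h1) (hexpl _ _ h1)
      have e2 := hest _ m₂ (Finset.mem_union_left _ h2) (hexpl _ _ h2)
      unfold pairDist
      rw [abs_lt] at e1 e2 ⊢
      refine ⟨fun h => ?_, fun h => ?_⟩
      · by_contra hne'
        have := hμ.le_abs_sub (hδ.le.trans hΔ)
          (fun he => hne' ((hty.2 (c s(m₁, m₂)) m₁ m₂).2 he))
        rw [le_abs] at this
        rcases this with h' | h' <;> linarith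
      · have := (hty.2 (c s(m₁, m₂)) m₁ m₂).1 h
        constructor <;> linarith
    rw [h𝒞.eq_typeClasses hd] at h
    rcases h with h | ⟨h1, h2, h3⟩
    · exact Or.inr (Or.inl h)
    · refine Or.inr (Or.inr ?_)
      have : Nonempty (Fin M) := ⟨a t⟩
      refine le_antisymm (ciSup_le fun m => ?_) (le_ciSup (f := fun m => μ (x t) m)
        (Set.finite_range _).bddAbove (a t))
      obtain ⟨m', hm', hm⟩ := hrep.exists_mem ty m
      rw [← (hty.2 (x t) m' m).1 hm]
      -- A suboptimal choice would lose at least δ in mean, more than the two estimation errors can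
      -- hide.
      by_contra! hlt
      have h4 := hμ.le_abs_sub (hδ.le.trans hΔ) hlt.ne'
      rw [abs_of_pos (sub_pos.2 hlt)] at h4
      have e1 := hest (x t) m' (Finset.mem_union_right _ hm') (by linarith [h1 m' hm'])
      have e2 := hest (x t) _ (Finset.mem_union_right _ h2) (by linarith [h1 _ h2])
      rw [abs_lt] at e1 e2
      linarith [h3 m' hm']

/-! ### Probabilistic estimates for the interaction -/

open scoped ENNReal

section Probability

set_option linter.unusedSectionVars false

variable {K M : ℕ} {Ω : Type*} [mΩ : MeasurableSpace Ω] {Pr : Measure Ω}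
  {P : Fin K → Fin M → Measure ℝ} {ℱ : Filtration ℕ mΩ}
  {x : ℕ → Ω → Fin K} {a : ℕ → Ω → Fin M} {r : ℕ → Fin K → Fin M → Ω → ℝ}

/-- The event that message `m` is recommended in context `k` in slot `t`. -/
def playSet (x : ℕ → Ω → Fin K) (a : ℕ → Ω → Fin M) (t : ℕ) (k : Fin K) (m : Fin M) : Set Ω :=
  {ω | x t ω = k ∧ a t ω = m}

/-- The factor of slot `t` in the exponential supermartingale of the payoffs of `m` in
context `k`. -/
def expFactor (P : Fin K → Fin M → Measure ℝ) (x : ℕ → Ω → Fin K) (a : ℕ → Ω → Fin M)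
    (r : ℕ → Fin K → Fin M → Ω → ℝ) (k : Fin K) (m : Fin M) (l : ℝ) (t : ℕ) (ω : Ω) : ℝ≥0∞ :=
  open Classical in
  if ω ∈ playSet x a t k m then
    ENNReal.ofReal (Real.exp (l * (r t k m ω - meanPayoff P k m) - l ^ 2 / 8)) else 1

/-- The event that at slot `t` the message `m` has at least `n₀` samples in context `k` and their
average is `ε` away from the mean. -/
def deviationSet (P : Fin K → Fin M → Measure ℝ) (x : ℕ → Ω → Fin K) (a : ℕ → Ω → Fin M)
    (r : ℕ → Fin K → Fin M → Ω → ℝ) (t : ℕ) (k : Fin K) (m : Fin M) (ε n₀ : ℝ) : Set Ω :=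
  {ω | n₀ ≤ count (fun u => x u ω) (fun u => a u ω) t k m ∧
    ε ≤ |empMean (fun u => x u ω) (fun u => a u ω) (fun u => r u (x u ω) (a u ω) ω) t k m
      - meanPayoff P k m|}

/-- The weight `e⁻¹` for the slots with context `k`. -/
def arrivalWeight (x : ℕ → Ω → Fin K) (k : Fin K) (t : ℕ) (ω : Ω) : ℝ≥0∞ :=
  if x t ω = k then ENNReal.ofReal (Real.exp (-1)) else 1

namespace Interaction

theorem comap_context_le (h : Interaction Pr P ℱ x a r) (t : ℕ) :
    MeasurableSpace.comap (x (t + 1)) ⊤ ≤ ℱ (t + 1) :=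
  (h.context_measurable t).comap_le

theorem info_le (h : Interaction Pr P ℱ x a r) (t : ℕ) :
    ℱ t ⊔ MeasurableSpace.comap (x (t + 1)) ⊤ ≤ ℱ (t + 1) :=
  sup_le (ℱ.mono t.le_succ) (h.comap_context_le t)

theorem measurableSet_context (t : ℕ) (k : Fin K) :
    MeasurableSet[MeasurableSpace.comap (x (t + 1)) ⊤] {ω | x (t + 1) ω = k} :=
  ⟨{k}, trivial, rfl⟩

theorem measurableSet_playSet_info (h : Interaction Pr P ℱ x a r) (t : ℕ) (k : Fin K)
    (m : Fin M) : MeasurableSet[ℱ t ⊔ MeasurableSpace.comap (x (t + 1)) ⊤]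
      (playSet x a (t + 1) k m) :=
  MeasurableSet.inter
    ((le_sup_right : _ ≤ ℱ t ⊔ MeasurableSpace.comap (x (t + 1)) ⊤) _
      (measurableSet_context t k))
    (h.action_measurable t (measurableSet_singleton m))

theorem measurableSet_playSet (h : Interaction Pr P ℱ x a r) (t : ℕ) (k : Fin K)
    (m : Fin M) : MeasurableSet (playSet x a (t + 1) k m) :=
  ℱ.le (t + 1) _ (h.info_le t _ (h.measurableSet_playSet_info t k m))

theorem measurable_payoff (h : Interaction Pr P ℱ x a r) (t : ℕ) (k : Fin K) (m : Fin M) :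
    Measurable (r (t + 1) k m) :=
  (h.payoff_measurable t k m).mono (ℱ.le _) le_rfl

theorem payoff_mem_Icc (h : Interaction Pr P ℱ x a r) (hP : IsPayoffLaw P) (t : ℕ)
    (k : Fin K) (m : Fin M) : ∀ᵐ ω ∂Pr, r (t + 1) k m ω ∈ Set.Icc (0 : ℝ) 1 := by
  have := (hP k m).2
  rw [← h.payoff_law t k m] at this
  exact ae_of_ae_map (h.measurable_payoff t k m).aemeasurable this

theorem integral_payoff (h : Interaction Pr P ℱ x a r) (t : ℕ) (k : Fin K) (m : Fin M) :
    ∫ ω, r (t + 1) k m ω ∂Pr = meanPayoff P k m := by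
  unfold meanPayoff
  rw [← h.payoff_law t k m,
    integral_map (h.measurable_payoff t k m).aemeasurable measurable_id'.aestronglyMeasurable]

variable [IsProbabilityMeasure Pr]

theorem integrable_payoff (h : Interaction Pr P ℱ x a r) (hP : IsPayoffLaw P) (t : ℕ)
    (k : Fin K) (m : Fin M) : Integrable (r (t + 1) k m) Pr := by
  refine Integrable.of_bound (h.measurable_payoff t k m).aestronglyMeasurable 1 ?_
  filter_upwards [h.payoff_mem_Icc hP t k m] with ω hω
  rw [Real.norm_eq_abs, abs_le]
  constructor <;> linarith [hω.1, hω.2]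

/-! ### Deviations of the empirical averages -/

/-- Hoeffding's lemma: a variable in [0, 1] is sub-Gaussian with variance proxy 1/4. -/
theorem lintegral_exp_payoff_le (h : Interaction Pr P ℱ x a r) (hP : IsPayoffLaw P) (t : ℕ)
    (k : Fin K) (m : Fin M) (l : ℝ) :
    ∫⁻ ω, ENNReal.ofReal (Real.exp (l * (r (t + 1) k m ω - meanPayoff P k m) - l ^ 2 / 8)) ∂Pr
      ≤ 1 := by
  have hsub := hasSubgaussianMGF_of_mem_Icc (h.measurable_payoff t k m).aemeasurable
    (h.payoff_mem_Icc hP t k m)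
  rw [h.integral_payoff t k m] at hsub
  have h1 := hsub.mgf_le l
  have h2 := hsub.integrable_exp_mul l
  have hc : ((((‖(1 : ℝ) - 0‖₊ / 2) ^ 2 : NNReal)) : ℝ) = 1 / 4 := by
    simp; norm_num
  rw [hc] at h1
  have h3 : Integrable (fun ω => Real.exp (l * (r (t + 1) k m ω - meanPayoff P k m) - l ^ 2 / 8))
      Pr := by
    simp_rw [Real.exp_sub]
    exact h2.div_const _
  rw [← ofReal_integral_eq_lintegral_ofReal h3 (ae_of_all _ fun _ => (Real.exp_pos _).le)]
  rw [ENNReal.ofReal_le_one]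
  simp_rw [Real.exp_sub]
  rw [integral_div, div_le_one (Real.exp_pos _)]
  refine h1.trans (Real.exp_le_exp.2 (le_of_eq ?_))
  ring

theorem measurable_expFactor (h : Interaction Pr P ℱ x a r) (k : Fin K) (m : Fin M) (l : ℝ)
    (t : ℕ) : Measurable[ℱ (t + 1)] (expFactor P x a r k m l (t + 1)) := by
  have h1 := h.payoff_measurable t k m
  refine Measurable.ite (h.info_le t _ (h.measurableSet_playSet_info t k m)) ?_
    measurable_const
  exact ENNReal.measurable_ofReal.comp
    (Real.measurable_exp.comp (((h1.sub_const _).const_mul l).sub_const _))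

theorem measurable_prod_expFactor (h : Interaction Pr P ℱ x a r) (k : Fin K) (m : Fin M) (l : ℝ)
    (n : ℕ) : Measurable[ℱ n] (fun ω => ∏ u ∈ Finset.Ico 1 (n + 1), expFactor P x a r k m l u ω) := by
  refine Finset.measurable_fun_prod _ fun u hu => ?_
  rw [Finset.mem_Ico] at hu
  obtain ⟨v, rfl⟩ : ∃ v, u = v + 1 := ⟨u - 1, by omega⟩
  exact (h.measurable_expFactor k m l v).mono (ℱ.mono (by omega)) le_rfl

/-- Supermartingale property: whether slot n + 1 plays (k, m) is decided by the past and the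
context, of which the payoff is independent. On a play the new factor has mean at most 1; otherwise
it equals 1. -/
theorem lintegral_prod_expFactor_le (h : Interaction Pr P ℱ x a r) (hP : IsPayoffLaw P)
    (k : Fin K) (m : Fin M) (l : ℝ) (n : ℕ) :
    ∫⁻ ω, ∏ u ∈ Finset.Ico 1 (n + 1), expFactor P x a r k m l u ω ∂Pr ≤ 1 := by
  induction n with
  | zero => simp
  | succ n ih =>
    set F : Ω → ℝ≥0∞ := fun ω => ∏ u ∈ Finset.Ico 1 (n + 1), expFactor P x a r k m l u ω with hF
    set E : Ω → ℝ≥0∞ := fun ω =>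
      ENNReal.ofReal (Real.exp (l * (r (n + 1) k m ω - meanPayoff P k m) - l ^ 2 / 8)) with hE
    set A := playSet x a (n + 1) k m with hA
    have hFm : Measurable[ℱ n] F := h.measurable_prod_expFactor k m l n
    have hFm' : Measurable[ℱ n ⊔ MeasurableSpace.comap (x (n + 1)) ⊤] F :=
      hFm.mono le_sup_left le_rfl
    have hFmΩ : Measurable F := hFm.mono (ℱ.le n) le_rfl
    have hAm := h.measurableSet_playSet n k m
    have hEm : Measurable[MeasurableSpace.comap (r (n + 1) k m) inferInstance] E := by
      have h1 : Measurable[MeasurableSpace.comap (r (n + 1) k m) inferInstance] (r (n + 1) k m) :=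
        comap_measurable _
      exact ENNReal.measurable_ofReal.comp
        (Real.measurable_exp.comp (((h1.sub_const _).const_mul l).sub_const _))
    have hsplit : ∀ ω, ∏ u ∈ Finset.Ico 1 (n + 1 + 1), expFactor P x a r k m l u ω
        = Aᶜ.indicator F ω + E ω * A.indicator F ω := by
      intro ω
      rw [Finset.prod_Ico_succ_top (by omega)]
      by_cases hω : ω ∈ A
      · simp [expFactor, hω, ← hA, hF, hE, mul_comm]
      · simp [expFactor, hω, ← hA, hF]
    simp_rw [hsplit]
    rw [lintegral_add_left (hFmΩ.indicator hAm.compl),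
      lintegral_mul_eq_lintegral_mul_lintegral_of_independent_measurableSpace
        (h.measurable_payoff n k m).comap_le ((h.info_le n).trans (ℱ.le _))
        (h.payoff_indep n k m) hEm (hFm'.indicator (h.measurableSet_playSet_info n k m))]
    calc _ ≤ ∫⁻ ω, Aᶜ.indicator F ω ∂Pr + 1 * ∫⁻ ω, A.indicator F ω ∂Pr := by
          gcongr
          exact h.lintegral_exp_payoff_le hP n k m l
      _ = ∫⁻ ω, F ω ∂Pr := by
          rw [one_mul, ← lintegral_add_left (hFmΩ.indicator hAm.compl)]
          congr 1
          ext ω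
          exact congrFun (Set.indicator_compl_add_self A F) ω
      _ ≤ 1 := ih

theorem prod_expFactor_eq (k : Fin K) (m : Fin M) (l : ℝ) (t : ℕ) (ω : Ω) :
    ∏ u ∈ Finset.Ico 1 t, expFactor P x a r k m l u ω =
      ENNReal.ofReal (Real.exp (l * (∑ u ∈ pastSlots (fun u => x u ω) (fun u => a u ω) t k m,
        (r u (x u ω) (a u ω) ω - meanPayoff P k m))
        - l ^ 2 / 8 * count (fun u => x u ω) (fun u => a u ω) t k m)) := by
  classical
  unfold expFactor
  rw [Finset.prod_ite, Finset.prod_const_one, mul_one,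
    ← ENNReal.ofReal_prod_of_nonneg (fun _ _ => (Real.exp_pos _).le), ← Real.exp_sum,
    Finset.sum_sub_distrib, ← Finset.mul_sum]
  have hfilter : (Finset.Ico 1 t).filter (fun u => ω ∈ playSet x a u k m) =
      pastSlots (fun u => x u ω) (fun u => a u ω) t k m := by
    ext u
    rw [pastSlots, Finset.mem_filter, Finset.mem_filter]
    rfl
  have hsum : ∑ u ∈ pastSlots (fun u => x u ω) (fun u => a u ω) t k m,
      (r u k m ω - meanPayoff P k m) =
      ∑ u ∈ pastSlots (fun u => x u ω) (fun u => a u ω) t k m,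
        (r u (x u ω) (a u ω) ω - meanPayoff P k m) := by
    refine Finset.sum_congr rfl fun u hu => ?_
    simp only [pastSlots, Finset.mem_filter] at hu
    rw [hu.2.1, hu.2.2]
  rw [hfilter, hsum, Finset.sum_const, nsmul_eq_mul, mul_comm (l ^ 2 / 8)]
  rfl

/-- Markov's inequality for the supermartingale with l = 4εσ, where σ = ±1 selects the tail. With N
samples the exponent is at least 4ε²N − 2ε²N = 2ε²N ≥ 2ε²n₀, so no union over the values of N is
needed. -/
theorem prob_signed_deviation_le (h : Interaction Pr P ℱ x a r) (hP : IsPayoffLaw P) (k : Fin K)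
    (m : Fin M) {t : ℕ} (ht : 1 ≤ t) (ε n₀ : ℝ) {σ : ℝ} (hσ : σ ^ 2 = 1) (hε : 0 ≤ ε) :
    Pr {ω | n₀ ≤ count (fun u => x u ω) (fun u => a u ω) t k m ∧
      ε * count (fun u => x u ω) (fun u => a u ω) t k m ≤
        σ * ∑ u ∈ pastSlots (fun u => x u ω) (fun u => a u ω) t k m,
          (r u (x u ω) (a u ω) ω - meanPayoff P k m)} ≤
      ENNReal.ofReal (Real.exp (-(2 * ε ^ 2 * n₀))) := by
  obtain ⟨n, rfl⟩ : ∃ n, t = n + 1 := ⟨t - 1, by omega⟩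
  set F : Ω → ℝ≥0∞ := fun ω =>
    ∏ u ∈ Finset.Ico 1 (n + 1), expFactor P x a r k m (4 * ε * σ) u ω with hF
  have hFm : Measurable F := (h.measurable_prod_expFactor k m _ n).mono (ℱ.le n) le_rfl
  have hpos : 0 < Real.exp (2 * ε ^ 2 * n₀) := Real.exp_pos _
  calc _ ≤ Pr {ω | ENNReal.ofReal (Real.exp (2 * ε ^ 2 * n₀)) ≤ F ω} := by
        refine measure_mono fun ω hω => ?_
        obtain ⟨h1, h2⟩ := hω
        simp only [Set.mem_ofPred_eq, hF, prod_expFactor_eq]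
        refine ENNReal.ofReal_le_ofReal (Real.exp_le_exp.2 ?_)
        have e1 : (4 * ε * σ) ^ 2 / 8 = 2 * ε ^ 2 := by
          rw [mul_pow, hσ]; ring
        rw [e1]
        have e2 := mul_le_mul_of_nonneg_left h2 (by positivity : 0 ≤ 4 * ε)
        have e3 := mul_le_mul_of_nonneg_left h1 (by positivity : 0 ≤ 2 * ε ^ 2)
        linarith
    _ ≤ (∫⁻ ω, F ω ∂Pr) / ENNReal.ofReal (Real.exp (2 * ε ^ 2 * n₀)) :=
        meas_ge_le_lintegral_div hFm.aemeasurable (by simpa using hpos) ENNReal.ofReal_ne_top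
    _ ≤ 1 / ENNReal.ofReal (Real.exp (2 * ε ^ 2 * n₀)) := by
        gcongr
        exact h.lintegral_prod_expFactor_le hP k m _ n
    _ = _ := by
        rw [Real.exp_neg, ENNReal.ofReal_inv_of_pos hpos, one_div]

theorem prob_deviationSet_le (h : Interaction Pr P ℱ x a r) (hP : IsPayoffLaw P) (k : Fin K)
    (m : Fin M) {t : ℕ} (ht : 1 ≤ t) {ε n₀ : ℝ} (hε : 0 ≤ ε) :
    Pr (deviationSet P x a r t k m ε n₀) ≤
      2 * ENNReal.ofReal (Real.exp (-(2 * ε ^ 2 * n₀))) := by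
  have h1 := h.prob_signed_deviation_le hP k m ht ε n₀ (σ := 1) (by norm_num) hε
  have h2 := h.prob_signed_deviation_le hP k m ht ε n₀ (σ := -1) (by norm_num) hε
  rw [two_mul]
  refine le_trans (le_trans (measure_mono ?_) (measure_union_le _ _)) (add_le_add h1 h2)
  rintro ω ⟨h3, h4⟩
  have hsum : ∑ u ∈ pastSlots (fun u => x u ω) (fun u => a u ω) t k m,
      (r u (x u ω) (a u ω) ω - meanPayoff P k m) =
      count (fun u => x u ω) (fun u => a u ω) t k m *
      (empMean (fun u => x u ω) (fun u => a u ω) (fun u => r u (x u ω) (a u ω) ω) t k m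
        - meanPayoff P k m) := by
    rw [Finset.sum_sub_distrib, Finset.sum_const, nsmul_eq_mul, mul_sub]
    congr 1
    unfold empMean
    -- Without samples the average is 0 by convention, and both sides vanish.
    by_cases hc : count (fun u => x u ω) (fun u => a u ω) t k m = 0
    · have : pastSlots (fun u => x u ω) (fun u => a u ω) t k m = ∅ := Finset.card_eq_zero.1 hc
      simp [this]
    · rw [mul_div_cancel₀]
      exact_mod_cast hc
  have hc0 : (0 : ℝ) ≤ count (fun u => x u ω) (fun u => a u ω) t k m := Nat.cast_nonneg _
  rcases le_abs.1 h4 with h5 | h5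
  · left
    refine ⟨h3, ?_⟩
    rw [hsum, one_mul, mul_comm]
    exact mul_le_mul_of_nonneg_left h5 hc0
  · right
    refine ⟨h3, ?_⟩
    rw [hsum, mul_comm]
    have := mul_le_mul_of_nonneg_left h5 hc0
    linarith

/-! ### Arrivals of users -/

/-- The mean is 1 − (1 − e⁻¹)/K ≤ 1 − 1/(2K), because e⁻¹ < 1/2. -/
theorem lintegral_arrivalWeight_le (h : Interaction Pr P ℱ x a r) (k : Fin K) (t : ℕ) :
    ∫⁻ ω, arrivalWeight x k (t + 1) ω ∂Pr ≤ ENNReal.ofReal (Real.exp (-(1 / (2 * K : ℝ)))) := by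
  have hA : MeasurableSet {ω | x (t + 1) ω = k} :=
    ℱ.le (t + 1) _ (h.comap_context_le t _ (measurableSet_context t k))
  set A := {ω | x (t + 1) ω = k} with hAdef
  have hw : ∀ ω, arrivalWeight x k (t + 1) ω =
      ENNReal.ofReal (1 - A.indicator (fun _ => 1 - Real.exp (-1)) ω) := by
    intro ω
    by_cases hω : x (t + 1) ω = k
    · simp [arrivalWeight, hAdef, hω]
    · simp [arrivalWeight, hAdef, hω]
  have he : Real.exp (-1) < 1 / 2 := by
    have := Real.exp_neg_one_lt_d9
    linarith
  have hi : Integrable (A.indicator fun _ => 1 - Real.exp (-1)) Pr :=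
    (integrable_const _).indicator hA
  simp_rw [hw]
  have hi' : Integrable (fun ω => 1 - A.indicator (fun _ => 1 - Real.exp (-1)) ω) Pr :=
    (integrable_const 1).sub hi
  rw [← ofReal_integral_eq_lintegral_ofReal hi' (ae_of_all _ fun ω => ?_)]
  · refine ENNReal.ofReal_le_ofReal ?_
    rw [integral_sub (integrable_const _) hi, integral_indicator_const _ hA,
      h.context_uniform t k]
    have h1 := Real.add_one_le_exp (-(1 / (2 * K : ℝ)))
    have h2 : (1 : ℝ) / (2 * K) ≤ 1 / K * (1 - Real.exp (-1)) := by
      have h3 : (1 : ℝ) / (2 * K) = 1 / K * (1 / 2) := by ring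
      rw [h3]
      exact mul_le_mul_of_nonneg_left (by linarith) (by positivity)
    simp only [integral_const, probReal_univ, smul_eq_mul]
    linarith
  · simp only [Pi.zero_apply]
    by_cases hω : ω ∈ A
    · simp [hω, (Real.exp_pos _).le]
    · simp [hω]

theorem measurable_arrivalWeight (k : Fin K) (t : ℕ) :
    Measurable[MeasurableSpace.comap (x (t + 1)) ⊤] (arrivalWeight x k (t + 1)) :=
  Measurable.ite (measurableSet_context t k) measurable_const measurable_const

theorem measurable_prod_arrivalWeight (h : Interaction Pr P ℱ x a r) (k : Fin K) {b n : ℕ}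
    (hb : 1 ≤ b) :
    Measurable[ℱ n] (fun ω => ∏ u ∈ Finset.Ico b (n + 1), arrivalWeight x k u ω) := by
  refine Finset.measurable_fun_prod _ fun u hu => ?_
  rw [Finset.mem_Ico] at hu
  obtain ⟨v, rfl⟩ : ∃ v, u = v + 1 := ⟨u - 1, by omega⟩
  exact (measurable_arrivalWeight k v).mono ((h.comap_context_le v).trans (ℱ.mono (by omega)))
    le_rfl

theorem lintegral_prod_arrivalWeight_le (h : Interaction Pr P ℱ x a r) (k : Fin K) {b : ℕ}
    (hb : 1 ≤ b) (n : ℕ) :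
    ∫⁻ ω, ∏ u ∈ Finset.Ico b (b + n), arrivalWeight x k u ω ∂Pr ≤
      ENNReal.ofReal (Real.exp (-(1 / (2 * K : ℝ)))) ^ n := by
  induction n with
  | zero => simp
  | succ n ih =>
    obtain ⟨v, hv⟩ : ∃ v, b + n = v + 1 := ⟨b + n - 1, by omega⟩
    rw [← add_assoc]
    simp_rw [Finset.prod_Ico_succ_top (show b ≤ b + n by omega)]
    rw [hv] at ih ⊢
    rw [lintegral_mul_eq_lintegral_mul_lintegral_of_independent_measurableSpace
      (ℱ.le v) ((h.comap_context_le v).trans (ℱ.le _)) (h.context_indep v).symm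
      (h.measurable_prod_arrivalWeight k hb) (measurable_arrivalWeight k v), pow_succ]
    gcongr
    exact h.lintegral_arrivalWeight_le k v

/-- Chernoff bound: the product of the weights is e to the minus number of arrivals, and
independence of the contexts bounds its mean. -/
theorem prob_few_arrivals_le (h : Interaction Pr P ℱ x a r) (k : Fin K) {b : ℕ}
    (hb : 1 ≤ b) (n : ℕ) (B : ℝ) :
    Pr {ω | (((Finset.Ico b (b + n)).filter (fun u => x u ω = k)).card : ℝ) ≤ B} ≤
      ENNReal.ofReal (Real.exp (B - n / (2 * K))) := by
  set F : Ω → ℝ≥0∞ := fun ω => ∏ u ∈ Finset.Ico b (b + n), arrivalWeight x k u ω with hF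
  have hFm : Measurable F := by
    rcases n with _ | n
    · simp [hF]
    · exact (h.measurable_prod_arrivalWeight (n := b + n) k hb).mono (ℱ.le _) le_rfl
  have hpos : 0 < Real.exp (-B) := Real.exp_pos _
  calc _ ≤ Pr {ω | ENNReal.ofReal (Real.exp (-B)) ≤ F ω} := by
        refine measure_mono fun ω hω => ?_
        simp only [Set.mem_ofPred_eq, hF, arrivalWeight] at hω ⊢
        rw [Finset.prod_ite, Finset.prod_const_one, mul_one, Finset.prod_const,
          ← ENNReal.ofReal_pow (Real.exp_pos _).le, ← Real.exp_nat_mul]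
        refine ENNReal.ofReal_le_ofReal (Real.exp_le_exp.2 ?_)
        linarith
    _ ≤ (∫⁻ ω, F ω ∂Pr) / ENNReal.ofReal (Real.exp (-B)) :=
        meas_ge_le_lintegral_div hFm.aemeasurable (by simpa using hpos) ENNReal.ofReal_ne_top
    _ ≤ ENNReal.ofReal (Real.exp (-(1 / (2 * K : ℝ)))) ^ n / ENNReal.ofReal (Real.exp (-B)) := by
        gcongr
        exact h.lintegral_prod_arrivalWeight_le k hb n
    _ = _ := by
        rw [← ENNReal.ofReal_pow (Real.exp_pos _).le, ← ENNReal.ofReal_div_of_pos hpos,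
          ← Real.exp_nat_mul, ← Real.exp_sub]
        congr 2
        ring

/-! ### The regret in terms of the means -/

/-- Removes the random indices, so that integrability and independence are needed only for fixed (k,
m). -/
theorem payoff_eq_sum (t : ℕ) (ω : Ω) (f : Fin K → Fin M → Ω → ℝ) :
    f (x t ω) (a t ω) ω = ∑ k, ∑ m, (playSet x a t k m).indicator (f k m) ω := by
  classical
  rw [Finset.sum_eq_single (x t ω), Finset.sum_eq_single (a t ω)]
  · simp [playSet]
  · intro m _ hm
    simp [playSet, hm.symm]
  · simp
  · intro k _ hk
    simp [playSet, hk.symm]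
  · simp

theorem integral_indicator_payoff (h : Interaction Pr P ℱ x a r) (t : ℕ)
    (k : Fin K) (m : Fin M) :
    ∫ ω, (playSet x a (t + 1) k m).indicator (r (t + 1) k m) ω ∂Pr =
      ∫ ω, (playSet x a (t + 1) k m).indicator (fun _ => meanPayoff P k m) ω ∂Pr := by
  set A := playSet x a (t + 1) k m with hA
  have hAm := h.measurableSet_playSet t k m
  have hind : IndepFun (A.indicator fun _ => (1 : ℝ)) (r (t + 1) k m) Pr := by
    have h1 := h.payoff_indep t k m
    refine (indep_of_indep_of_le_right h1 ?_).symm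
    exact (measurable_const.indicator (h.measurableSet_playSet_info t k m)).comap_le
  have h2 := hind.integral_fun_mul_eq_mul_integral
    (measurable_const.indicator hAm).aestronglyMeasurable
    (h.measurable_payoff t k m).aestronglyMeasurable
  have h3 : ∀ ω, A.indicator (r (t + 1) k m) ω =
      A.indicator (fun _ => (1 : ℝ)) ω * r (t + 1) k m ω := by
    intro ω
    by_cases hω : ω ∈ A <;> simp [hω]
  simp_rw [h3]
  rw [h2, h.integral_payoff, integral_indicator_const _ hAm, integral_indicator_const _ hAm]
  simp

theorem integrable_play (h : Interaction Pr P ℱ x a r) (t : ℕ) {f : Fin K → Fin M → Ω → ℝ}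
    (hf : ∀ k m, Integrable (f k m) Pr) :
    Integrable (fun ω => f (x (t + 1) ω) (a (t + 1) ω) ω) Pr := by
  simp_rw [payoff_eq_sum (x := x) (a := a) (t + 1) _ f]
  exact integrable_finsetSum _ fun k _ => integrable_finsetSum _ fun m _ =>
    (hf k m).indicator (h.measurableSet_playSet t k m)

theorem integral_play (h : Interaction Pr P ℱ x a r) (hP : IsPayoffLaw P) (t : ℕ) :
    ∫ ω, r (t + 1) (x (t + 1) ω) (a (t + 1) ω) ω ∂Pr =
      ∫ ω, meanPayoff P (x (t + 1) ω) (a (t + 1) ω) ∂Pr := by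
  rw [integral_congr_ae (ae_of_all _ fun ω => payoff_eq_sum (x := x) (a := a) (t + 1) ω (r (t + 1))),
    integral_congr_ae (ae_of_all _ fun ω => payoff_eq_sum (x := x) (a := a) (t + 1) ω
      (fun k m _ => meanPayoff P k m))]
  rw [integral_finsetSum _ fun k _ => integrable_finsetSum _ fun m _ =>
      (h.integrable_payoff hP t k m).indicator (h.measurableSet_playSet t k m),
    integral_finsetSum _ fun k _ => integrable_finsetSum _ fun m _ =>
      (integrable_const _).indicator (h.measurableSet_playSet t k m)]
  refine Finset.sum_congr rfl fun k _ => ?_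
  rw [integral_finsetSum _ fun m _ =>
      (h.integrable_payoff hP t k m).indicator (h.measurableSet_playSet t k m),
    integral_finsetSum _ fun m _ =>
      (integrable_const _).indicator (h.measurableSet_playSet t k m)]
  exact Finset.sum_congr rfl fun m _ => h.integral_indicator_payoff t k m

theorem integrable_gap (h : Interaction Pr P ℱ x a r) (t : ℕ) :
    Integrable (fun ω => (⨆ m, meanPayoff P (x (t + 1) ω) m)
      - meanPayoff P (x (t + 1) ω) (a (t + 1) ω)) Pr :=
  h.integrable_play t (f := fun k m _ => (⨆ m', meanPayoff P k m') - meanPayoff P k m)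
    fun _ _ => integrable_const _

theorem regret_eq (h : Interaction Pr P ℱ x a r) (hP : IsPayoffLaw P) (T : ℕ) :
    regret Pr P x a r T = ∫ ω, ∑ t ∈ Finset.Icc 1 T, ((⨆ m, meanPayoff P (x t ω) m)
      - meanPayoff P (x t ω) (a t ω)) ∂Pr := by
  have hidx : ∀ t ∈ Finset.Icc 1 T, ∃ n, t = n + 1 := fun t ht =>
    ⟨t - 1, by rw [Finset.mem_Icc] at ht; omega⟩
  have hmax : ∀ n, Integrable (fun ω => ⨆ m, meanPayoff P (x (n + 1) ω) m) Pr := fun n =>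
    h.integrable_play n (f := fun k _ _ => ⨆ m', meanPayoff P k m') fun _ _ => integrable_const _
  have hpay : ∀ n, Integrable (fun ω => r (n + 1) (x (n + 1) ω) (a (n + 1) ω) ω) Pr := fun n =>
    h.integrable_play n (f := r (n + 1)) fun k m => h.integrable_payoff hP n k m
  have hmean : ∀ n, Integrable (fun ω => meanPayoff P (x (n + 1) ω) (a (n + 1) ω)) Pr := fun n =>
    h.integrable_play n (f := fun k m _ => meanPayoff P k m) fun _ _ => integrable_const _
  unfold regret
  simp_rw [← Finset.sum_sub_distrib]
  rw [integral_finsetSum, integral_finsetSum]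
  · refine Finset.sum_congr rfl fun t ht => ?_
    obtain ⟨n, rfl⟩ := hidx t ht
    rw [integral_sub (hmax n) (hpay n), integral_sub (hmax n) (hmean n), h.integral_play hP n]
  · intro t ht
    obtain ⟨n, rfl⟩ := hidx t ht
    exact (hmax n).sub (hmean n)
  · intro t ht
    obtain ⟨n, rfl⟩ := hidx t ht
    exact (hmax n).sub (hpay n)

end Interaction

end Probability

/-! ### The size of the covering design -/

/-- Within a residue class mod g a message is determined by its quotient by g, which is at most M /
g. -/
theorem card_fin_mod_eq_le (M g i : ℕ) :
    ((Finset.univ : Finset (Fin M)).filter fun m : Fin M => (m : ℕ) % g = i).card ≤ M / g + 1 := by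
  rw [← Finset.card_range (M / g + 1)]
  refine Finset.card_le_card_of_injOn (fun m : Fin M => (m : ℕ) / g) ?_ ?_
  · intro m _
    simp only [Finset.coe_range, Set.mem_Iio]
    exact Nat.lt_succ_of_le (Nat.div_le_div_right m.2.le)
  · intro m₁ h₁ m₂ h₂ h
    simp only [Finset.coe_filter, Finset.mem_univ, true_and, Set.mem_ofPred_eq] at h₁ h₂
    apply Fin.ext
    rw [← Nat.div_add_mod (m₁ : ℕ) g, ← Nat.div_add_mod (m₂ : ℕ) g, h₁, h₂]
    simp only at h
    rw [h]

/-- Splitting the messages into `g` groups and taking all unions of two groups covers all pairs. -/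
theorem exists_coversPairs (K M : ℕ) {g : ℕ} (hg : 0 < g) (hgK : g * g ≤ K) :
    ∃ (S : Fin K → Finset (Fin M)) (s : ℕ), CoversPairs S s ∧ s ≤ 2 * (M / g + 1) := by
  -- All sets must have exactly the same size, so the unions of groups are padded up to `s`; the
  -- minimum with `M` leaves room for this.
  set s := min M (2 * (M / g + 1)) with hs
  have hcard : ∀ k : Fin K, ((Finset.univ : Finset (Fin M)).filter fun m : Fin M =>
      (m : ℕ) % g = (k : ℕ) / g ∨ (m : ℕ) % g = (k : ℕ) % g).card ≤ s := by
    intro k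
    refine le_min (by simpa using Finset.card_filter_le (Finset.univ : Finset (Fin M)) _) ?_
    rw [Finset.filter_or]
    have h1 := card_fin_mod_eq_le M g ((k : ℕ) / g)
    have h2 := card_fin_mod_eq_le M g ((k : ℕ) % g)
    exact (Finset.card_union_le _ _).trans (by omega)
  choose S hsub hS using fun k => Finset.exists_superset_card_eq (hcard k)
    (by rw [Fintype.card_fin]; exact min_le_left _ _)
  refine ⟨S, s, ⟨hS, fun m₁ m₂ _ => ?_⟩, min_le_right _ _⟩
  have h1 := Nat.mod_lt (m₁ : ℕ) hg
  have h2 := Nat.mod_lt (m₂ : ℕ) hg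
  -- A context encodes a pair of groups by its two digits in base g.
  have hk : (m₁ : ℕ) % g * g + (m₂ : ℕ) % g < K := by
    have : ((m₁ : ℕ) % g + 1) * g ≤ g * g := Nat.mul_le_mul_right g h1
    rw [add_mul] at this
    omega
  refine ⟨⟨_, hk⟩, hsub _ ?_, hsub _ ?_⟩
  · rw [Finset.mem_filter]
    refine ⟨Finset.mem_univ _, Or.inl ?_⟩
    change _ = ((m₁ : ℕ) % g * g + (m₂ : ℕ) % g) / g
    rw [mul_comm, Nat.mul_add_div hg, Nat.div_eq_of_lt h2, add_zero]
  · rw [Finset.mem_filter]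
    refine ⟨Finset.mem_univ _, Or.inr ?_⟩
    change _ = ((m₁ : ℕ) % g * g + (m₂ : ℕ) % g) % g
    rw [mul_comm, Nat.mul_add_mod, Nat.mod_mod]

/-- Minimality compares s with the explicit covering for g = ⌊√K⌋ ≥ √K / 2, giving s ≤ 4M/√K + 2. As
log(MK) ≥ 1/4 for M ≥ 2, the root of the logarithm costs another factor 2. -/
theorem IsPairAllocation.exists_card {K M : ℕ} {S : Fin K → Finset (Fin M)}
    {c : Sym2 (Fin M) → Fin K} (hS : IsPairAllocation S c) (hK : 0 < K) (hM : 0 < M) :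
    ∃ s : ℕ, (∀ k, (S k).card = s) ∧
      (s : ℝ) ≤ 8 * (M * Real.sqrt (Real.log ((M : ℝ) * K) / K)) + 2 := by
  obtain ⟨⟨s, ⟨hcard, -⟩, hmin⟩, -⟩ := hS
  refine ⟨s, hcard, ?_⟩
  have hQ : 0 ≤ (M : ℝ) * Real.sqrt (Real.log ((M : ℝ) * K) / K) := by positivity
  -- A single message forms no pairs, so s = 0; here log(MK) may vanish.
  rcases Nat.lt_or_ge M 2 with hM2 | hM2
  · have h0 : s ≤ 0 := by
      refine hmin (fun _ => ∅) 0 ⟨fun _ => Finset.card_empty, fun m₁ m₂ hne => ?_⟩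
      exact absurd (Fin.ext (by omega)) hne
    have : (s : ℝ) ≤ 0 := by exact_mod_cast h0
    linarith
  · have hg : 0 < Nat.sqrt K := Nat.sqrt_pos.2 hK
    obtain ⟨S', s', hS', hs'⟩ := exists_coversPairs K M hg (Nat.sqrt_le K)
    have hle := (hmin S' s' hS').trans hs'
    set g := Nat.sqrt K with hgdef
    have hgR : (0 : ℝ) < g := by exact_mod_cast hg
    have hKR : (0 : ℝ) < K := by exact_mod_cast hK
    have hsK : 0 < Real.sqrt K := Real.sqrt_pos.2 hKR
    have hMR : (2 : ℝ) ≤ M := by exact_mod_cast hM2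
    have h1 : (s : ℝ) ≤ 2 * (M / g + 1) := by
      have h2 : (s : ℝ) ≤ 2 * (((M / g : ℕ) : ℝ) + 1) := by exact_mod_cast hle
      have h3 : ((M / g : ℕ) : ℝ) ≤ M / g := Nat.cast_div_le
      linarith
    have h2 : Real.sqrt K ≤ 2 * g := by
      rw [Real.sqrt_le_left (by positivity)]
      have h3 : K < (g + 1) * (g + 1) := Nat.lt_succ_sqrt K
      have h4 : (K : ℝ) ≤ ((g : ℝ) + 1) * (g + 1) := by exact_mod_cast h3.le
      have h5 : (1 : ℝ) ≤ g := by exact_mod_cast hg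
      nlinarith
    have h3 : (M : ℝ) / g ≤ 2 * (M / Real.sqrt K) := by
      rw [← mul_div_assoc, div_le_div_iff₀ hgR hsK]
      nlinarith
    have h4 : 1 / Real.sqrt K ≤ 2 * Real.sqrt (Real.log ((M : ℝ) * K) / K) := by
      rw [Real.sqrt_div' _ hKR.le, ← mul_div_assoc]
      refine div_le_div_of_nonneg_right ?_ hsK.le
      have h5 : (1 / 2 : ℝ) ^ 2 ≤ Real.log ((M : ℝ) * K) := by
        have h6 : Real.log 2 ≤ Real.log ((M : ℝ) * K) := by
          refine Real.log_le_log (by norm_num) ?_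
          have : (1 : ℝ) ≤ K := by exact_mod_cast hK
          nlinarith
        have := Real.log_two_gt_d9
        linarith
      have := Real.le_sqrt_of_sq_le h5
      linarith
    have h5 : (M : ℝ) / Real.sqrt K ≤
        2 * (M * Real.sqrt (Real.log ((M : ℝ) * K) / K)) := by
      have := mul_le_mul_of_nonneg_left h4 (by linarith : (0 : ℝ) ≤ M)
      rw [mul_one_div] at this
      linarith
    linarith

/-! ### Bad events and the regret bound -/

theorem sum_Icc_inv_sq_le (T : ℕ) : ∑ t ∈ Finset.Icc 1 T, ((t : ℝ) ^ 2)⁻¹ ≤ 2 := by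
  have h := sum_Ioo_inv_sq_le (α := ℝ) 0 (T + 1)
  have h2 : Finset.Icc 1 T = Finset.Ioo 0 (T + 1) := by
    ext t; simp only [Finset.mem_Icc, Finset.mem_Ioo]; omega
  rw [h2]
  simpa using h

theorem sum_ite_le_of_nonneg (T : ℕ) {τ : ℝ} (hτ : 0 ≤ τ) :
    ∑ t ∈ Finset.Icc 1 T, (if (t : ℝ) ≤ τ then (1 : ℝ) else 0) ≤ τ := by
  rw [Finset.sum_boole]
  refine le_trans (Nat.cast_le.2 ?_) (Nat.floor_le hτ)
  calc _ ≤ (Finset.Icc 1 ⌊τ⌋₊).card := by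
        refine Finset.card_le_card fun t ht => ?_
        simp only [Finset.mem_filter, Finset.mem_Icc] at ht ⊢
        exact ⟨ht.1.1, Nat.le_floor ht.2⟩
    _ = ⌊τ⌋₊ := by simp

/-- The bad event of one slot: either some estimate of a relevant
context and message is off, or the slot is late and some context was rare recently. -/
def badSet {K M : ℕ} {Ω : Type*} (δ τ b : ℝ) (P : Fin K → Fin M → Measure ℝ)
    (x : ℕ → Ω → Fin K) (a : ℕ → Ω → Fin M) (r : ℕ → Fin K → Fin M → Ω → ℝ)
    (R : Fin K → Finset (Fin M)) (t : ℕ) : Set Ω :=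
  (⋃ k, ⋃ m ∈ R k, deviationSet P x a r t k m (δ / 4) (threshold δ t / 2)) ∪
  ⋃ k, {ω | τ < t ∧ 1 ≤ b ∧
    (((Finset.Ico (t / 2 + 1) t).filter (fun u => x u ω = k)).card : ℝ) ≤ b}

section

set_option linter.unusedSectionVars false

variable {K M L : ℕ} {Ω : Type*} [mΩ : MeasurableSpace Ω] {Pr : Measure Ω}
  {P : Fin K → Fin M → Measure ℝ} {ℱ : Filtration ℕ mΩ}
  {x : ℕ → Ω → Fin K} {a : ℕ → Ω → Fin M} {r : ℕ → Fin K → Fin M → Ω → ℝ}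

/-- The constant 32 in the threshold is what makes accuracy δ/4 with D(t)/2 samples fail with the
summable rate t⁻². -/
theorem exp_neg_threshold_eq {δ : ℝ} (hδ : 0 < δ) {t : ℕ} (ht : 1 ≤ t) :
    Real.exp (-(2 * (δ / 4) ^ 2 * (threshold δ t / 2))) = ((t : ℝ) ^ 2)⁻¹ := by
  have h1 : 2 * (δ / 4) ^ 2 * (threshold δ t / 2) = 2 * Real.log t := by
    unfold threshold
    field_simp
    ring
  have ht' : (0 : ℝ) < t := by exact_mod_cast ht
  rw [h1, Real.exp_neg, two_mul, Real.exp_add, Real.exp_log ht', sq]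

theorem two_mul_log_le_threshold {δ : ℝ} (hδ : 0 < δ) (hδ1 : δ ≤ 1) (t : ℕ) :
    2 * Real.log t ≤ threshold δ t := by
  unfold threshold
  refine mul_le_mul_of_nonneg_right ?_ (Real.log_natCast_nonneg t)
  rw [le_div_iff₀ (by positivity)]
  nlinarith

theorem Interaction.prob_badSet_le [IsProbabilityMeasure Pr] (h : Interaction Pr P ℱ x a r)
    (hP : IsPayoffLaw P) {δ : ℝ} (hδ : 0 < δ) (hδ1 : δ ≤ 1) {b : ℝ} {t T : ℕ} (ht : 1 ≤ t)
    (htT : t ≤ T) (hb : 1 ≤ b → threshold δ T ≤ b) {R : Fin K → Finset (Fin M)} {n : ℕ}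
    (hR : ∀ k, (R k).card ≤ n) :
    Pr (badSet δ (16 * K * b + 4) b P x a r R t) ≤
      ENNReal.ofReal (2 * (K * n) * ((t : ℝ) ^ 2)⁻¹ + (T : ℝ)⁻¹) := by
  have hdev : Pr (⋃ k, ⋃ m ∈ R k, deviationSet P x a r t k m (δ / 4) (threshold δ t / 2)) ≤
      ENNReal.ofReal (2 * (K * n) * ((t : ℝ) ^ 2)⁻¹) := by
    have h1 : ∀ k, Pr (⋃ m ∈ R k, deviationSet P x a r t k m (δ / 4) (threshold δ t / 2)) ≤
        n * (2 * ENNReal.ofReal ((t : ℝ) ^ 2)⁻¹) := by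
      intro k
      refine (measure_biUnion_finset_le _ _).trans ?_
      refine (Finset.sum_le_card_nsmul _ _ (2 * ENNReal.ofReal ((t : ℝ) ^ 2)⁻¹)
        fun m _ => ?_).trans ?_
      · rw [← exp_neg_threshold_eq hδ ht]
        exact h.prob_deviationSet_le hP k m ht (by positivity)
      · rw [nsmul_eq_mul]
        gcongr
        exact hR k
    refine (measure_iUnion_fintype_le _ _).trans ((Finset.sum_le_sum fun k _ => h1 k).trans ?_)
    rw [Finset.sum_const, Finset.card_univ, Fintype.card_fin, nsmul_eq_mul,
      ENNReal.ofReal_mul (by positivity), ENNReal.ofReal_mul (by positivity),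
      ENNReal.ofReal_mul (by positivity), ENNReal.ofReal_natCast, ENNReal.ofReal_natCast,
      ENNReal.ofReal_ofNat]
    exact le_of_eq (by ring)
  have hfew : Pr (⋃ k, {ω | 16 * K * b + 4 < (t : ℝ) ∧ 1 ≤ b ∧
      (((Finset.Ico (t / 2 + 1) t).filter (fun u => x u ω = k)).card : ℝ) ≤ b}) ≤
      ENNReal.ofReal (T : ℝ)⁻¹ := by
    by_cases hc : 16 * K * b + 4 < (t : ℝ) ∧ 1 ≤ b
    · obtain ⟨hτ, hb1⟩ := hc
      have hT0 : (0 : ℝ) < T := by exact_mod_cast ht.trans htT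
      have htT' : (t : ℝ) ≤ T := by exact_mod_cast htT
      -- A late slot exists only if T exceeds K, so the union over K contexts of events of
      -- probability T⁻² costs at most T⁻¹.
      have hKT : (K : ℝ) ≤ T := by
        have : (K : ℝ) * 1 ≤ K * b := mul_le_mul_of_nonneg_left hb1 (Nat.cast_nonneg K)
        have h0 : (0 : ℝ) ≤ K := Nat.cast_nonneg K
        linarith
      have hexp : Real.exp (-b) ≤ ((T : ℝ) ^ 2)⁻¹ := by
        have h1 : 2 * Real.log T ≤ b := (two_mul_log_le_threshold hδ hδ1 T).trans (hb hb1)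
        calc Real.exp (-b) ≤ Real.exp (-(2 * Real.log T)) := Real.exp_le_exp.2 (by linarith)
          _ = _ := by rw [Real.exp_neg, two_mul, Real.exp_add, Real.exp_log hT0, sq]
      have h1 : ∀ k, Pr {ω | 16 * K * b + 4 < (t : ℝ) ∧ 1 ≤ b ∧
          (((Finset.Ico (t / 2 + 1) t).filter (fun u => x u ω = k)).card : ℝ) ≤ b} ≤
          ENNReal.ofReal ((T : ℝ) ^ 2)⁻¹ := by
        intro k
        have hK0 : (0 : ℝ) < K := by exact_mod_cast k.pos
        have ht4 : 4 < t := by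
          have h2 : (0 : ℝ) ≤ 16 * K * b := by positivity
          have h3 : (4 : ℝ) < t := by linarith
          exact_mod_cast h3
        have hfew := h.prob_few_arrivals_le k (b := t / 2 + 1) (by omega) (t - (t / 2 + 1)) b
        rw [Nat.add_sub_cancel' (by omega)] at hfew
        refine (measure_mono fun ω hω => hω.2.2).trans (hfew.trans (ENNReal.ofReal_le_ofReal ?_))
        refine le_trans (Real.exp_le_exp.2 ?_) hexp
        have h4 : t ≤ 4 * (t - (t / 2 + 1)) := by omega
        have h5 : (t : ℝ) ≤ 4 * ((t - (t / 2 + 1) : ℕ) : ℝ) := by exact_mod_cast h4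
        -- The window has at least t/4 > 4Kb slots; this is the origin of the factor 16. The
        -- Chernoff exponent is then at most b − 2b = −b.
        have h6 : 2 * b ≤ ((t - (t / 2 + 1) : ℕ) : ℝ) / (2 * K) := by
          rw [le_div_iff₀ (by positivity)]
          nlinarith
        linarith
      refine (measure_iUnion_fintype_le _ _).trans ((Finset.sum_le_sum fun k _ => h1 k).trans ?_)
      rw [Finset.sum_const, Finset.card_univ, Fintype.card_fin, nsmul_eq_mul,
        ← ENNReal.ofReal_natCast, ← ENNReal.ofReal_mul (by positivity)]
      refine ENNReal.ofReal_le_ofReal ?_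
      rw [← div_eq_mul_inv, div_le_iff₀ (by positivity), sq, ← mul_assoc, inv_mul_cancel₀ hT0.ne',
        one_mul]
      exact hKT
    · rw [Set.iUnion_eq_empty.2 fun k => Set.eq_empty_of_forall_notMem
        fun ω hω => hc ⟨hω.1, hω.2.1⟩, measure_empty]
      exact zero_le
  rw [ENNReal.ofReal_add (by positivity) (by positivity)]
  exact (measure_union_le _ _).trans (add_le_add hdev hfew)

/-- Outside the bad events, the regret of a slot is caused by its being early or exploring. -/
theorem gap_le {δ Δ : ℝ} (hδ : 0 < δ) (hΔ : δ ≤ Δ)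
    (hμ : DiscretePayoffs (meanPayoff P) Δ) {ty : Fin M → Fin L}
    (hty : LatentTypes (meanPayoff P) ty) {S : Fin K → Finset (Fin M)}
    {c : Sym2 (Fin M) → Fin K} {rep : Finset (Finset (Fin M)) → Finset (Fin M)}
    (hS : IsPairAllocation S c) (hrep : IsRepresentativeRule rep) {s : ℕ}
    (hs : ∀ k, (S k).card = s) {ω : Ω}
    (halg : ∀ t, 1 ≤ t → AlgorithmStep δ S c rep (fun u => x u ω) (fun u => a u ω)
      (fun u => r u (x u ω) (a u ω) ω) t) {T t : ℕ} (htT : t ≤ T) {τ : ℝ} (hτ : 4 ≤ τ) :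
    (⨆ m, meanPayoff P (x t ω) m) - meanPayoff P (x t ω) (a t ω) ≤
      (if (t : ℝ) ≤ τ then 1 else 0) +
      (if a t ω ∈ S (x t ω) ∧ (count (fun u => x u ω) (fun u => a u ω) t (x t ω) (a t ω) : ℝ) <
        threshold δ T then 1 else 0) +
      (if a t ω ∈ rep (typeClasses ty) ∧
        (count (fun u => x u ω) (fun u => a u ω) t (x t ω) (a t ω) : ℝ) < threshold δ T
        then 1 else 0) +
      (badSet δ τ (s * (threshold δ T + 1)) P x a r (fun k => S k ∪ rep (typeClasses ty)) t).indicator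
        (fun _ => (1 : ℝ)) ω := by
  set B := badSet δ τ (s * (threshold δ T + 1)) P x a r (fun k => S k ∪ rep (typeClasses ty)) t
    with hB
  have : Nonempty (Fin M) := ⟨a t ω⟩
  have hgap : (⨆ m, meanPayoff P (x t ω) m) - meanPayoff P (x t ω) (a t ω) ≤ 1 := by
    have h1 : (⨆ m, meanPayoff P (x t ω) m) ≤ 1 := ciSup_le fun m => (hμ (x t ω) m).2
    obtain ⟨⟨j, -, hj⟩, -⟩ := hμ (x t ω) (a t ω)
    have h2 : 0 ≤ meanPayoff P (x t ω) (a t ω) := by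
      rw [hj]
      exact mul_nonneg (Nat.cast_nonneg j) (hδ.le.trans hΔ)
    linarith
  have hind : 0 ≤ B.indicator (fun _ => (1 : ℝ)) ω := Set.indicator_nonneg (by simp) ω
  by_cases ht : (t : ℝ) ≤ τ
  · rw [if_pos ht]
    split_ifs <;> linarith
  by_cases hω : ω ∈ B
  · rw [Set.indicator_of_mem hω]
    split_ifs <;> linarith
  rw [not_le] at ht
  have ht4 : 4 < t := by
    have : (4 : ℝ) < t := by linarith
    exact_mod_cast this
  have hmono := threshold_mono δ (show 1 ≤ t by omega) htT
  simp only [hB, badSet, Set.mem_union, Set.mem_iUnion, not_or, not_exists] at hω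
  have hcases := (halg t (by omega)).cases hδ hΔ hμ hty hS hrep ?_ ?_
  · rcases hcases with ⟨h1, h2⟩ | ⟨h1, h2⟩ | h1
    · rw [if_pos (show a t ω ∈ S (x t ω) ∧ _ from ⟨h1, h2.trans_le hmono⟩)]
      split_ifs <;> linarith
    · rw [if_pos (show a t ω ∈ rep (typeClasses ty) ∧ _ from ⟨h1, h2.trans_le hmono⟩)]
      split_ifs <;> linarith
    · rw [h1, sub_self]
      split_ifs <;> linarith
  · intro k m hm
    by_contra! hlt
    have hcard := card_arrivals_le_of_underexplored halg ht4.le htT hm hlt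
    rw [hs k] at hcard
    refine hω.2 k ⟨ht, ?_, hcard⟩
    -- An underexplored message makes `S k` nonempty, which yields the clause 1 ≤ b of the bad
    -- event.
    have hs1 : 1 ≤ s := hs k ▸ Finset.card_pos.2 ⟨m, hm⟩
    have hs1' : (1 : ℝ) ≤ s := by exact_mod_cast hs1
    nlinarith [threshold_nonneg δ T]
  · intro k m hm hcount
    by_contra! hge
    exact hω.1 k m hm ⟨hcount, hge⟩

theorem sum_gap_le {δ Δ : ℝ} (hδ : 0 < δ) (hΔ : δ ≤ Δ)
    (hμ : DiscretePayoffs (meanPayoff P) Δ) {ty : Fin M → Fin L}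
    (hty : LatentTypes (meanPayoff P) ty) {S : Fin K → Finset (Fin M)}
    {c : Sym2 (Fin M) → Fin K} {rep : Finset (Finset (Fin M)) → Finset (Fin M)}
    (hS : IsPairAllocation S c) (hrep : IsRepresentativeRule rep) {s : ℕ}
    (hs : ∀ k, (S k).card = s) {ω : Ω}
    (halg : ∀ t, 1 ≤ t → AlgorithmStep δ S c rep (fun u => x u ω) (fun u => a u ω)
      (fun u => r u (x u ω) (a u ω) ω) t) (T : ℕ) {τ : ℝ} (hτ : 4 ≤ τ) :
    ∑ t ∈ Finset.Icc 1 T, ((⨆ m, meanPayoff P (x t ω) m) - meanPayoff P (x t ω) (a t ω)) ≤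
      τ + K * (s * (threshold δ T + 1)) + K * (L * (threshold δ T + 1)) +
      ∑ t ∈ Finset.Icc 1 T, (badSet δ τ (s * (threshold δ T + 1)) P x a r
        (fun k => S k ∪ rep (typeClasses ty)) t).indicator (fun _ => (1 : ℝ)) ω := by
  refine (Finset.sum_le_sum fun t ht => gap_le hδ hΔ hμ hty hS hrep hs halg
    (Finset.mem_Icc.1 ht).2 hτ).trans ?_
  rw [Finset.sum_add_distrib, Finset.sum_add_distrib, Finset.sum_add_distrib]
  refine add_le_add (add_le_add (add_le_add ?_ ?_) ?_) le_rfl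
  · exact sum_ite_le_of_nonneg T (by linarith)
  · rw [Finset.sum_boole]
    exact card_underexplored_le (fun u => x u ω) (fun u => a u ω) T (threshold_nonneg δ T) S
      (fun k => (hs k).le)
  · rw [Finset.sum_boole]
    exact card_underexplored_le (fun u => x u ω) (fun u => a u ω) T (threshold_nonneg δ T)
      (fun _ => rep (typeClasses ty)) (fun _ => hrep.card_le ty)

theorem Interaction.regret_le [IsProbabilityMeasure Pr] (h : Interaction Pr P ℱ x a r)
    (hP : IsPayoffLaw P) {δ Δ : ℝ} (hδ : 0 < δ) (hδ1 : δ ≤ 1) (hΔ : δ ≤ Δ)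
    (hμ : DiscretePayoffs (meanPayoff P) Δ) {ty : Fin M → Fin L}
    (hty : LatentTypes (meanPayoff P) ty) {S : Fin K → Finset (Fin M)}
    {c : Sym2 (Fin M) → Fin K} {rep : Finset (Finset (Fin M)) → Finset (Fin M)}
    (hS : IsPairAllocation S c) (hrep : IsRepresentativeRule rep) {s : ℕ}
    (hs : ∀ k, (S k).card = s)
    (halg : ∀ᵐ ω ∂Pr, ∀ t, 1 ≤ t → AlgorithmStep δ S c rep (fun u => x u ω) (fun u => a u ω)
      (fun u => r u (x u ω) (a u ω) ω) t) {T : ℕ} (hT : 1 ≤ T) :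
    regret Pr P x a r T ≤ 17 * (K * (s + L)) * (threshold δ T + 1) + 4 * (K * (s + L)) + 5 := by
  set D := threshold δ T with hD
  have hD0 : 0 ≤ D := threshold_nonneg δ T
  set b : ℝ := s * (D + 1) with hb
  have hb0 : 0 ≤ b := by positivity
  set τ : ℝ := 16 * K * b + 4 with hτ
  have hτ4 : 4 ≤ τ := by
    have : (0 : ℝ) ≤ 16 * K * b := by positivity
    linarith
  -- A measurable hull has the same probability as the bad event and lets its indicator be
  -- integrated without proving the event measurable.
  set B : ℕ → Set Ω := fun t => toMeasurable Pr
    (badSet δ τ b P x a r (fun k => S k ∪ rep (typeClasses ty)) t) with hBdef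
  have hBm : ∀ t, MeasurableSet (B t) := fun t => measurableSet_toMeasurable _ _
  have hBprob : ∀ t ∈ Finset.Icc 1 T, Pr.real (B t) ≤
      2 * (K * (s + L)) * ((t : ℝ) ^ 2)⁻¹ + (T : ℝ)⁻¹ := by
    intro t ht
    rw [Finset.mem_Icc] at ht
    refine ENNReal.toReal_le_of_le_ofReal (by positivity) ?_
    rw [hBdef, measure_toMeasurable]
    have := h.prob_badSet_le hP hδ hδ1 (b := b) ht.1 ht.2 ?_ (n := s + L)
      (R := fun k => S k ∪ rep (typeClasses ty)) ?_
    · rwa [Nat.cast_add] at this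
    · intro h1
      have hs0 : s ≠ 0 := by
        rintro rfl
        simp only [hb, Nat.cast_zero, zero_mul] at h1
        linarith
      have hs1 : (1 : ℝ) ≤ s := by exact_mod_cast Nat.one_le_iff_ne_zero.2 hs0
      rw [hb]
      nlinarith
    · intro k
      exact (Finset.card_union_le _ _).trans (add_le_add (hs k).le (hrep.card_le ty))
  have hBint : ∀ t, Integrable ((B t).indicator fun _ => (1 : ℝ)) Pr := fun t =>
    (integrable_const _).indicator (hBm t)
  have hBsum : Integrable (fun ω => ∑ t ∈ Finset.Icc 1 T, (B t).indicator (fun _ => (1 : ℝ)) ω) Pr :=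
    integrable_finsetSum _ fun t _ => hBint t
  have hgap : Integrable (fun ω => ∑ t ∈ Finset.Icc 1 T, ((⨆ m, meanPayoff P (x t ω) m)
      - meanPayoff P (x t ω) (a t ω))) Pr := by
    refine integrable_finsetSum _ fun t ht => ?_
    rw [Finset.mem_Icc] at ht
    obtain ⟨n, rfl⟩ : ∃ n, t = n + 1 := ⟨t - 1, by omega⟩
    exact h.integrable_gap n
  rw [h.regret_eq hP]
  calc _ ≤ ∫ ω, (τ + K * b + K * (L * (D + 1)) +
        ∑ t ∈ Finset.Icc 1 T, (B t).indicator (fun _ => (1 : ℝ)) ω) ∂Pr := by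
        refine integral_mono_ae hgap ((integrable_const _).add hBsum) ?_
        filter_upwards [halg] with ω hω
        refine (sum_gap_le hδ hΔ hμ hty hS hrep hs hω T hτ4).trans ?_
        refine add_le_add le_rfl (Finset.sum_le_sum fun t _ => ?_)
        exact Set.indicator_le_indicator_of_subset (subset_toMeasurable _ _)
          (fun _ => zero_le_one) ω
    _ = τ + K * b + K * (L * (D + 1)) + ∑ t ∈ Finset.Icc 1 T, Pr.real (B t) := by
        rw [integral_add (integrable_const _) hBsum, integral_finsetSum _ fun t _ => hBint t]
        simp [integral_indicator_const, hBm]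
    _ ≤ τ + K * b + K * (L * (D + 1)) + (4 * (K * (s + L)) + 1) := by
        gcongr
        refine (Finset.sum_le_sum hBprob).trans ?_
        rw [Finset.sum_add_distrib, ← Finset.mul_sum, Finset.sum_const, Nat.card_Icc,
          Nat.add_sub_cancel, nsmul_eq_mul, mul_inv_cancel₀ (by exact_mod_cast (by omega : T ≠ 0))]
        have h1 := sum_Icc_inv_sq_le T
        have h2 : (0 : ℝ) ≤ 2 * (K * (s + L)) := by positivity
        nlinarith
    _ ≤ _ := by
        have h1 : (0 : ℝ) ≤ K * (L * (D + 1)) := by positivity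
        rw [hτ, hb]
        nlinarith

end

end LatentBandit

end

/-! ### The theorem and its constant -/

theorem theorem3 (δ : ℝ) (hδ : 0 < δ) :
    ∃ C : ℝ, ∀ (K M L : ℕ)
      (P : Fin K → Fin M → MeasureTheory.Measure ℝ) (Δ : ℝ) (ty : Fin M → Fin L)
      (_ : LatentBandit.IsPayoffLaw P) (_ : δ ≤ Δ)
      (_ : LatentBandit.DiscretePayoffs (LatentBandit.meanPayoff P) Δ)
      (_ : LatentBandit.LatentTypes (LatentBandit.meanPayoff P) ty)
      (S : Fin K → Finset (Fin M)) (c : Sym2 (Fin M) → Fin K)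
      (rep : Finset (Finset (Fin M)) → Finset (Fin M))
      (_ : LatentBandit.IsPairAllocation S c) (_ : LatentBandit.IsRepresentativeRule rep)
      (Ω : Type*) (mΩ : MeasurableSpace Ω) (Pr : MeasureTheory.Measure Ω)
      (_ : MeasureTheory.IsProbabilityMeasure Pr) (ℱ : MeasureTheory.Filtration ℕ mΩ)
      (x : ℕ → Ω → Fin K) (a : ℕ → Ω → Fin M) (r : ℕ → Fin K → Fin M → Ω → ℝ)
      (_ : LatentBandit.Interaction Pr P ℱ x a r)
      (_ : ∀ᵐ ω ∂Pr, ∀ t : ℕ, 1 ≤ t → LatentBandit.AlgorithmStep δ S c rep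
        (fun u => x u ω) (fun u => a u ω) (fun u => r u (x u ω) (a u ω) ω) t)
      (T : ℕ), 2 ≤ T →
      LatentBandit.regret Pr P x a r T ≤
        C * ((K : ℝ) * M * Real.sqrt (Real.log ((M : ℝ) * K) / K) + (K : ℝ) * L) * Real.log T := by
  -- 208 = 26 · 8: here 26 = 17 + 4 + 5 collects the regret terms, using 1 ≤ W ≤ W(D + 1) for W =
  -- K(s + L), and 8 comes from the bound on s. The summand 2 absorbs the 1 in D + 1, as log T ≥
  -- 1/2.
  refine ⟨208 * (32 / δ ^ 2 + 2), ?_⟩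
  intro K M L P Δ ty hP hΔ hμ hty S c rep hS hrep Ω mΩ Pr hPr ℱ x a r h halg T hT
  obtain ⟨ω⟩ := MeasureTheory.nonempty_of_isProbabilityMeasure Pr
  have hK : 0 < K := (x 0 ω).pos
  have hM : 0 < M := (a 0 ω).pos
  have hL : 0 < L := (ty (a 0 ω)).pos
  -- A mean is a positive multiple of Δ ≥ δ and at most 1.
  have hδ1 : δ ≤ 1 := by
    obtain ⟨⟨j, hj1, hj⟩, hle⟩ := hμ (x 0 ω) (a 0 ω)
    have : (1 : ℝ) ≤ j := by exact_mod_cast hj1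
    nlinarith
  obtain ⟨s, hs, hsle⟩ := hS.exists_card hK hM
  have hreg := h.regret_le hP hδ hδ1 hΔ hμ hty hS hrep hs halg (T := T) (by omega)
  set Q := Real.sqrt (Real.log ((M : ℝ) * K) / K) with hQ
  have hQ0 : 0 ≤ Q := Real.sqrt_nonneg _
  have hK1 : (1 : ℝ) ≤ K := by exact_mod_cast hK
  have hL1 : (1 : ℝ) ≤ L := by exact_mod_cast hL
  have hs0 : (0 : ℝ) ≤ s := Nat.cast_nonneg s
  have hlog : 1 / 2 ≤ Real.log T := by
    have h1 : Real.log 2 ≤ Real.log T := Real.log_le_log (by norm_num) (by exact_mod_cast hT)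
    have := Real.log_two_gt_d9
    linarith
  have hD : LatentBandit.threshold δ T + 1 ≤ (32 / δ ^ 2 + 2) * Real.log T := by
    unfold LatentBandit.threshold
    linarith
  have hD0 := LatentBandit.threshold_nonneg δ T
  set D := LatentBandit.threshold δ T
  have hW1 : (1 : ℝ) ≤ K * (s + L) := by nlinarith
  have hW : (K : ℝ) * (s + L) ≤ 8 * (K * M * Q + K * L) := by
    have h1 : (s : ℝ) + L ≤ 8 * (M * Q + L) := by linarith
    have h2 := mul_le_mul_of_nonneg_left h1 (by linarith : (0 : ℝ) ≤ K)
    linarith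
  set W : ℝ := K * (s + L)
  calc LatentBandit.regret Pr P x a r T ≤ 17 * W * (D + 1) + 4 * W + 5 := hreg
    _ ≤ 26 * (W * (D + 1)) := by nlinarith
    _ ≤ 26 * ((8 * (K * M * Q + K * L)) * ((32 / δ ^ 2 + 2) * Real.log T)) := by
        gcongr
    _ = _ := by ring
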